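/- Let $\mathbf{K}$ be an ordered field, $\mathbf{R}$ a real closed field that is an ordered extension of $\mathbf{K}$, $u=(u_1,\dots,u_k)$, and let $\mathcal{Q}\subset \mathbf{K}[u,y]$ be a finite family of polynomials that are monic in $y$. Definitions. For $P\in\mathbf{K}[u,y]$ monic in $y$ with $p=\deg_y P$, all derivatives $P^{(h)}$ are with respect to $y$, and $\mathrm{Der}_+(P)=\{P,P^{(1)},\dots,P^{(p-1)}\}$ (for $p=0$, $\mathrm{Der}_+(P)=\{P\}$). Put $\mathrm{Der}_+(\mathcal{Q})=\bigcup_{P\in\mathcal{Q}}\mathrm{Der}_+(P)$. For $i\in\mathbb{N}$ and $Q\in\mathbf{K}[u,y]$ let $$\mathrm{PDer}_i(P)=\Big\{\prod_{1\le h\le p-1}(P^{(h)})^{\alpha_h}\ \Big|\ \alpha\in\{0,1,2\}^{\{1,\dots,p-1\}},\ \#\{h\mid\alpha_h\neq0\}\le i\Big\},$$ $$\mathrm{PDer}_i(P;Q)=\{AB\mid A\in\mathrm{PDer}_i(P),\ B\in\{Q,Q^2\}\}.$$ The Hermite matrix $\mathrm{Her}(P;A)\in\mathbf{K}[u]^{p\times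 p}$ has as entry of index $(j_1,j_2)$, $1\le j_1,j_2\le p$, the trace of multiplication by $A\,y^{j_1+j_2-2}$ on $\mathbf{K}[u][y]/(P)$, and $\mathrm{HMi}(P;A)\subset\mathbf{K}[u]$ is the set of its leading principal minors of sizes $1,\dots,p$ (empty if $p=0$). Let $\mathrm{bit}\{p\}$ be the number of binary digits of $p\ge 1$, and $$\mathrm{ThElim}(P)=\bigcup_{A\in\mathrm{PDer}_{\mathrm{bit}\{p\}}(P)}\mathrm{HMi}(P;A),\qquad \mathrm{ThElim}(P;Q)=\bigcup_{A\in\mathrm{PDer}_{\mathrm{bit}\{p\}-1}(P;Q)}\mathrm{HMi}(P;A)$$ (both empty if $p=0$), $$\mathrm{Elim}(\mathcal{Q})=\Big(\bigcup_{P\in\mathcal{Q}}\mathrm{ThElim}(P)\Big)\cup\Big(\bigcup_{P\in\mathcal{Q},\ Q\in\mathrm{Der}_+(\mathcal{Q})\setminus\mathrm{Der}_+(P)}\mathrm{ThElim}(P;Q)\Big)\subset\mathbf{K}[u].$$ A sign condition on a set $\mathcal{S}$ of polynomials is an element of $\{-1,0,1\}^{\mathcal{S}}$. For a sign condition $\tau$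 on a set $\mathcal{S}\subset\mathbf{K}[u]$, $\mathrm{Real}(\tau,\mathbf{R})=\{\upsilon\in\mathbf{R}^k\mid \mathrm{sign}(H(\upsilon))=\tau(H)\text{ for all }H\in\mathcal{S}\}$, and $\tau$ is realizable if $\mathrm{Real}(\tau,\mathbf{R})\neq\emptyset$. Theorem (Elimination of One Variable). For every realizable sign condition $\tau$ on $\mathrm{Elim}(\mathcal{Q})$ there exists a list $\mathrm{SIGN}(\mathcal{Q}\mid\tau)$ of sign conditions on $\mathcal{Q}$ such that, for every $\upsilon\in\mathrm{Real}(\tau,\mathbf{R})$, the elements of $\mathrm{SIGN}(\mathcal{Q}\mid\tau)$ are exactly the sign conditions $\sigma$ on $\mathcal{Q}$ for which there is $y\in\mathbf{R}$ with $\mathrm{sign}(Q(\upsilon,y))=\sigma(Q)$ for all $Q\in\mathcal{Q}$. -/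

import Mathlib

open scoped Polynomial

/-- A sign condition on a set `S` is an element of `{-1, 0, 1} ^ S`. -/
abbrev SignCondition {α : Type*} (S : Set α) : Type _ := S → SignType

/-- `PDer i P`: the products `∏_{1 ≤ h ≤ p - 1} (P^{(h)}) ^ α_h`, where `p = deg P`, every `α_h` is
in `{0, 1, 2}`, and at most `i` of the exponents are nonzero. -/
def PDer {A : Type*} [CommRing A] (i : ℕ) (P : A[X]) : Set A[X] :=
  {B | ∃ α : ℕ → ℕ, (∀ h, α h ≤ 2) ∧
    ((Finset.Icc 1 (P.natDegree - 1)).filter (fun h => α h ≠ 0)).card ≤ i ∧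
    B = ∏ h ∈ Finset.Icc 1 (P.natDegree - 1), (Polynomial.derivative^[h] P) ^ α h}

/-- `PDerWith i P Q`: the products `B * C` with `B ∈ PDer i P` and `C ∈ {Q, Q ^ 2}`. -/
def PDerWith {A : Type*} [CommRing A] (i : ℕ) (P Q : A[X]) : Set A[X] :=
  {D | ∃ B ∈ PDer i P, D = B * Q ∨ D = B * Q ^ 2}

/-- The leading `n × n` block of the Hermite matrix of `P` and `Q`: its entry of index `(i, j)`
(counted from `0`) is the trace of multiplication by `Q * y ^ (i + j)` on `A[y] / (P)`. For
`n = deg P` it is the Hermite matrix itself. -/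
noncomputable def hermiteBlock {A : Type*} [CommRing A] (P Q : A[X]) (n : ℕ) :
    Matrix (Fin n) (Fin n) A :=
  Matrix.of fun i j =>
    Algebra.trace A (AdjoinRoot P) (AdjoinRoot.mk P (Q * Polynomial.X ^ ((i : ℕ) + (j : ℕ))))

/-- The leading principal minors, of sizes `1, …, deg P`, of the Hermite matrix of `P` and `Q`. -/
def HMi {A : Type*} [CommRing A] (P Q : A[X]) : Set A :=
  {m | ∃ n : ℕ, 1 ≤ n ∧ n ≤ P.natDegree ∧ m = (hermiteBlock P Q n).det}

/-- The union of the `HMi P B` over `B ∈ PDer (bit p) P`, where `p = deg P` and `bit p`, here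
`Nat.size p`, is the number of binary digits of `p`. -/
def ThElim {A : Type*} [CommRing A] (P : A[X]) : Set A :=
  ⋃ B ∈ PDer (Nat.size P.natDegree) P, HMi P B

/-- The union of the `HMi P B` over `B ∈ PDerWith (bit p - 1) P Q`, where `p = deg P`. -/
def ThElimWith {A : Type*} [CommRing A] (P Q : A[X]) : Set A :=
  ⋃ B ∈ PDerWith (Nat.size P.natDegree - 1) P Q, HMi P B

/-- `P` together with its first `deg P - 1` derivatives. -/
def DerPlus {A : Type*} [CommRing A] (P : A[X]) : Set A[X] :=
  insert P {D | ∃ h : ℕ, 1 ≤ h ∧ h ≤ P.natDegree - 1 ∧ D = Polynomial.derivative^[h] P}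

/-- The union of the `DerPlus P` over the family. -/
def DerPlusFamily {A : Type*} [CommRing A] (𝒬 : Finset A[X]) : Set A[X] :=
  ⋃ P ∈ 𝒬, DerPlus P

/-- The eliminating family of a finite family of univariate polynomials. -/
def Elim {A : Type*} [CommRing A] (𝒬 : Finset A[X]) : Set A :=
  (⋃ P ∈ 𝒬, ThElim P) ∪
    ⋃ P ∈ 𝒬, ⋃ Q ∈ DerPlusFamily 𝒬 \ DerPlus P, ThElimWith P Q

/-- The realization in `R ^ k` of a sign condition on a set of polynomials in `K[u_1, …, u_k]`. -/
def Realization {K : Type*} [CommRing K] {k : ℕ} {S : Set (MvPolynomial (Fin k) K)}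
    (τ : SignCondition S) (R : Type*) [CommRing R] [LinearOrder R] [Algebra K R] :
    Set (Fin k → R) :=
  {υ | ∀ H : S, SignType.sign (MvPolynomial.aeval υ (H : MvPolynomial (Fin k) K)) = τ H}

/-- The univariate polynomial `P(υ, y)`, for `P ∈ K[u_1, …, u_k][y]`. -/
noncomputable def specialize {K R : Type*} [CommRing K] [CommRing R] [Algebra K R] {k : ℕ}
    (υ : Fin k → R) (P : (MvPolynomial (Fin k) K)[X]) : R[X] :=
  P.map (MvPolynomial.aeval υ : MvPolynomial (Fin k) K →ₐ[K] R).toRingHom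

/-- The sign conditions on `𝒬` that are realized, in the variable `y`, after specializing the
parameters to `υ`. -/
def realizableSignConditions {K R : Type*} [CommRing K] [CommRing R] [LinearOrder R] [Algebra K R]
    {k : ℕ} (𝒬 : Finset (MvPolynomial (Fin k) K)[X]) (υ : Fin k → R) :
    Set (SignCondition (𝒬 : Set (MvPolynomial (Fin k) K)[X])) :=
  {σ | ∃ y : R, ∀ P : (𝒬 : Set (MvPolynomial (Fin k) K)[X]),
    SignType.sign ((specialize υ (P : (MvPolynomial (Fin k) K)[X])).eval y) = σ P}

open Polynomial Module

/-! ### Galois theory over a real closed field -/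

section RealClosedGalois

/-! Over a real closed field, the signs of the family at `y` are controlled by the largest root `x ≤
y` of a member of the family. If there is no such root, each sign is given by the parity of a
degree. If `y = x`, it is the sign at the root. Otherwise it is the sign of the first nonvanishing
derivative at `x`. So two parameter points realize the same sign conditions as soon as every root of
a member at one point has a counterpart, a root of the same member at the other point with the same
signs on `DerPlusFamily 𝒬`. The orders of the roots need not be compared
(`realizableSignConditions_subset`).

The matching of roots is `exists_root_sign_eq`. By Thom's lemma the derivative signs (the Thom code)
separate the roots of `P`. The roots with a given code are counted through Tarski queries, that is,
sums of the sign of `A` over the roots of `P`, with `A` a product of powers of derivatives. Few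
factors suffice, since a function on sign vectors with at most `m` nonzero values is determined by
its moments with at most `log₂ m` nonzero exponents (`eq_zero_of_forall_sum_mul_prod_pow_eq_zero`).
With `p = deg P`, two parameter points give at most `2 * p` codes, hence `bit p` factors. Once the
codes are known to agree there are at most `p` of them, so one factor fewer is enough when the roots
are weighted by the sign of another `Q`.

A Tarski query is the signature of a Hermite form, and the signature of a Hankel form is determined
by the signs of its leading principal minors even when some of them vanish (`exists_index_sets`,
`sum_sign_roots_eq_of_sign_hermite_eq`). Since `P` is monic, these minors commute with
specialization, so their signs are prescribed by `τ`.

The facts needed about real closed fields (intermediate values, Rolle, Thom) come from factoring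
into linear and positive quadratic factors, which rests on `R(i)` being algebraically closed. -/

theorem finrank_eq_one_of_odd {R F : Type*} [Field R] [IsRealClosed R] [Field F] [Algebra R F]
    [FiniteDimensional R F] (hodd : Odd (finrank R F)) : finrank R F = 1 := by
  rw [← IntermediateField.bot_eq_top_iff_finrank_eq_one, eq_comm]
  refine eq_bot_iff.2 fun y _ => ?_
  have hint : IsIntegral R y := Algebra.IsIntegral.isIntegral y
  have hodd' : Odd (minpoly R y).natDegree :=
    hodd.of_dvd_nat (minpoly.degree_dvd hint)
  obtain ⟨x, hx⟩ := IsRealClosed.exists_isRoot_of_odd_natDegree hodd'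
  have hdeg := degree_eq_one_of_irreducible_of_root (minpoly.irreducible hint) hx
  exact IntermediateField.mem_bot.2 (minpoly.mem_range_of_degree_eq_one R y hdeg)

/-- The fixed field of a Sylow 2-subgroup has odd degree over `R`, hence equals `R`, so the Galois
group is a 2-group. -/
theorem finrank_eq_two_pow {R E : Type*} [Field R] [IsRealClosed R] [Field E] [Algebra R E]
    [FiniteDimensional R E] [IsGalois R E] : ∃ k : ℕ, finrank R E = 2 ^ k := by
  obtain ⟨P⟩ : Nonempty (Sylow 2 Gal(E/R)) := inferInstance
  have h1 : finrank (IntermediateField.fixedField (P : Subgroup Gal(E/R))) E =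
      Nat.card P := IntermediateField.finrank_fixedField_eq_card _
  have h2 := finrank_mul_finrank R (IntermediateField.fixedField (P : Subgroup Gal(E/R))) E
  have h3 : Nat.card Gal(E/R) = finrank R E := IsGalois.card_aut_eq_finrank R E
  have h4 := (P : Subgroup Gal(E/R)).index_mul_card
  have hpos : 0 < Nat.card P := Nat.card_pos
  have h5 : finrank R (IntermediateField.fixedField (P : Subgroup Gal(E/R))) =
      (P : Subgroup Gal(E/R)).index := by
    rw [h3, ← h2, h1] at h4
    exact (Nat.eq_of_mul_eq_mul_right hpos h4).symm
  have hodd : Odd (finrank R (IntermediateField.fixedField (P : Subgroup Gal(E/R)))) := by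
    rw [h5, ← Nat.not_even_iff_odd, even_iff_two_dvd]
    exact P.not_dvd_index
  rw [finrank_eq_one_of_odd hodd, one_mul, h1] at h2
  obtain ⟨k, hk⟩ := IsPGroup.iff_card.1 P.isPGroup'
  exact ⟨k, by rw [← h2]; exact hk⟩

/-- When every discriminant is a square, the quadratic formula gives every quadratic a root in `C`,
so no irreducible quadratic exists. -/
theorem finrank_ne_two_of_forall_isSquare {C F : Type*} [Field C] [NeZero (2 : C)] [Field F]
    [Algebra C F] (hsq : ∀ z : C, IsSquare z) : finrank C F ≠ 2 := by
  intro h2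
  have : FiniteDimensional C F := .of_finrank_pos (by omega)
  have hne : (⊥ : IntermediateField C F) ≠ ⊤ := by
    rw [Ne, IntermediateField.bot_eq_top_iff_finrank_eq_one]; omega
  obtain ⟨y, -, hy⟩ := SetLike.exists_of_lt (lt_top_iff_ne_top.2 hne)
  have hint : IsIntegral C y := Algebra.IsIntegral.isIntegral y
  have hirr := minpoly.irreducible hint
  have hdvd : (minpoly C y).natDegree ∣ 2 := h2 ▸ minpoly.degree_dvd hint
  have hroot : ∃ x, (minpoly C y).IsRoot x := by
    rcases (Nat.dvd_prime Nat.prime_two).1 hdvd with h | h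
    · obtain ⟨x, hx⟩ := exists_root_of_degree_eq_one
        (degree_eq_iff_natDegree_eq_of_pos one_pos |>.2 h)
      exact ⟨x, hx⟩
    · have hne0 : (minpoly C y).coeff 2 ≠ 0 := by
        rw [← h]; exact leadingCoeff_ne_zero.2 hirr.ne_zero
      obtain ⟨x, hx⟩ := exists_quadratic_eq_zero (b := (minpoly C y).coeff 1)
        (c := (minpoly C y).coeff 0) hne0 (hsq _)
      refine ⟨x, ?_⟩
      rw [IsRoot, eval_eq_sum_range, h]
      simp only [Finset.sum_range_succ, Finset.sum_range_zero]
      linear_combination hx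
  obtain ⟨x, hx⟩ := hroot
  exact hy (IntermediateField.mem_bot.2 (minpoly.mem_range_of_degree_eq_one C y
    (degree_eq_one_of_irreducible_of_root hirr hx)))

/-- A nontrivial 2-group has a subgroup of index 2, whose fixed field would be a quadratic extension
of `C`. -/
theorem finrank_eq_one_of_forall_isSquare {C E : Type*} [Field C] [NeZero (2 : C)] [Field E]
    [Algebra C E] [FiniteDimensional C E] [IsGalois C E] (hsq : ∀ z : C, IsSquare z) {k : ℕ}
    (hk : finrank C E = 2 ^ k) : finrank C E = 1 := by
  rcases k with _ | k
  · simpa using hk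
  exfalso
  have h3 : Nat.card Gal(E/C) = finrank C E := IsGalois.card_aut_eq_finrank C E
  have : Fact (Nat.Prime 2) := ⟨Nat.prime_two⟩
  obtain ⟨H, hH⟩ := Sylow.exists_subgroup_card_pow_prime (G := Gal(E/C)) 2 (n := k)
    (by rw [h3, hk]; exact pow_dvd_pow _ (Nat.le_succ k))
  have h1 : finrank (IntermediateField.fixedField H) E = Nat.card H :=
    IntermediateField.finrank_fixedField_eq_card _
  have h2 := finrank_mul_finrank C (IntermediateField.fixedField H) E
  rw [h1, hH, hk, pow_succ, mul_comm] at h2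
  exact finrank_ne_two_of_forall_isSquare hsq
    (Nat.eq_of_mul_eq_mul_left (pow_pos two_pos k) h2)

end RealClosedGalois

/-! ### The field `R(i)` is algebraically closed -/

section Complexification

variable {R : Type*} [Field R] [LinearOrder R] [IsStrictOrderedRing R]

/-- This is the form in which the field structure on `QuadraticAlgebra R (-1) 0` expects the
irreducibility of `X ^ 2 + 1`. -/
instance fact_sq_ne_neg_one : Fact (∀ r : R, r ^ 2 ≠ -1 + 0 * r) :=
  ⟨fun r h => by nlinarith [sq_nonneg r]⟩

/-- The field `R(i)` obtained from an ordered field by adjoining a square root of `-1`. -/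
abbrev Complexification (R : Type*) [Field R] : Type _ := QuadraticAlgebra R (-1) 0

instance : CharZero (Complexification R) :=
  charZero_of_injective_algebraMap (algebraMap R (Complexification R)).injective

variable [IsRealClosed R]

/-- With `r` the modulus of `x + i y`, a square root is `s ± i t` where `s² = (r + x) / 2` and `t² =
(r - x) / 2`; the sign is dictated by `2 s t = ± y`. -/
theorem Complexification.isSquare (z : Complexification R) : IsSquare z := by
  obtain ⟨x, y⟩ := z
  obtain ⟨r, hr0, hr⟩ : ∃ r : R, 0 ≤ r ∧ r * r = x * x + y * y := by
    obtain ⟨s, hs⟩ := IsSquare.of_nonneg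
      (add_nonneg (mul_self_nonneg x) (mul_self_nonneg y))
    exact ⟨|s|, abs_nonneg _, by rw [abs_mul_abs_self, hs]⟩
  have hxr : |x| ≤ r := abs_le_of_sq_le_sq (by nlinarith [mul_self_nonneg y]) hr0
  obtain ⟨h1, h2⟩ := abs_le.1 hxr
  obtain ⟨s, hs⟩ := IsSquare.of_nonneg (show 0 ≤ (r + x) / 2 by linarith)
  obtain ⟨t, ht⟩ := IsSquare.of_nonneg (show 0 ≤ (r - x) / 2 by linarith)
  have hst : (2 * s * t) ^ 2 = y ^ 2 := by
    have : (2 * s * t) ^ 2 = 4 * (s * s) * (t * t) := by ring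
    rw [this, ← hs, ← ht]; linear_combination hr
  have h3 : s * s - t * t = x := by rw [← hs, ← ht]; ring
  rcases sq_eq_sq_iff_eq_or_eq_neg.1 hst with h | h
  · refine ⟨⟨s, t⟩, ?_⟩
    ext
    · simp; linear_combination -h3
    · simp; linear_combination -h
  · refine ⟨⟨s, -t⟩, ?_⟩
    ext
    · simp; linear_combination -h3
    · simp; linear_combination h

theorem Complexification.splits_map (g : R[X]) :
    (g.map (algebraMap R (Complexification R))).Splits := by
  by_cases hg : g = 0
  · simp [hg]
  -- The extra factor embeds `R(i)` into the splitting field `E`. The degree of `E` over `R(i)`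
  -- divides a power of 2, hence is 1.
  let f : R[X] := (X ^ 2 + 1) * g
  let E := f.SplittingField
  have hf0 : f ≠ 0 := mul_ne_zero (by
    intro h
    have := congrArg (fun q : R[X] => q.coeff 2) h
    simp [coeff_one] at this) hg
  have : IsGalois R E := { }
  have hsplit : (f.map (algebraMap R E)).Splits := SplittingField.splits f
  have hX : ((X ^ 2 + 1 : R[X]).map (algebraMap R E)).Splits :=
    hsplit.of_dvd (map_ne_zero hf0) (Polynomial.map_dvd _ (dvd_mul_right _ _))
  have hgE : (g.map (algebraMap R E)).Splits :=
    hsplit.of_dvd (map_ne_zero hf0) (Polynomial.map_dvd _ (dvd_mul_left _ _))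
  obtain ⟨i, hi⟩ := hX.exists_eval_eq_zero (by
    rw [degree_map]
    have : (X ^ 2 + 1 : R[X]).degree = 2 := by compute_degree!
    rw [this]; decide)
  have hi' : i * i = (-1 : R) • (1 : E) + (0 : R) • i := by
    simp at hi
    simp
    linear_combination hi
  let φ : Complexification R →ₐ[R] E := QuadraticAlgebra.lift ⟨i, hi'⟩
  let : Algebra (Complexification R) E := φ.toRingHom.toAlgebra
  have : IsScalarTower R (Complexification R) E :=
    IsScalarTower.of_algebraMap_eq fun x => (φ.commutes x).symm
  have : FiniteDimensional (Complexification R) E := FiniteDimensional.right R _ E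
  have : IsGalois (Complexification R) E := IsGalois.tower_top_of_isGalois R _ E
  obtain ⟨k, hk⟩ := finrank_eq_two_pow (R := R) (E := E)
  have hmul := finrank_mul_finrank R (Complexification R) E
  rw [hk] at hmul
  obtain ⟨j, -, hj⟩ := (Nat.dvd_prime_pow Nat.prime_two).1 (Dvd.intro_left _ hmul)
  have h1 := finrank_eq_one_of_forall_isSquare Complexification.isSquare hj
  have hbij : Function.Surjective (algebraMap (Complexification R) E) := by
    rw [← IntermediateField.bot_eq_top_iff_finrank_eq_one] at h1
    intro x
    exact IntermediateField.mem_bot.1 (h1 ▸ IntermediateField.mem_top)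
  let e : Complexification R ≃+* E :=
    RingEquiv.ofBijective (algebraMap (Complexification R) E) ⟨RingHom.injective _, hbij⟩
  have h2 := hgE.map (e.symm : E →+* Complexification R)
  rw [Polynomial.map_map] at h2
  convert h2 using 2
  ext1 x
  apply e.injective
  exact (IsScalarTower.algebraMap_apply R (Complexification R) E x).symm.trans
    (e.apply_symm_apply _).symm

instance Complexification.isAlgClosed : IsAlgClosed (Complexification R) :=
  (IsAlgClosure.of_splits (R := R) (K := Complexification R)
    fun g _ _ => Complexification.splits_map g).isAlgClosed

end Complexification

/-- A root `a + i b` in `R(i)` gives a linear factor if `b = 0`. Otherwise the remainder modulo `(X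
- a)² + b²` has degree at most 1 and a nonreal root, so it is zero. The order-theoretic facts below
are checked factor by factor. -/
theorem Polynomial.Monic.induction_realClosed {R : Type*} [Field R] [LinearOrder R]
    [IsStrictOrderedRing R] [IsRealClosed R] {motive : R[X] → Prop} (one : motive 1)
    (linear : ∀ (r : R) (f : R[X]), f.Monic → motive f → motive ((X - C r) * f))
    (quadratic : ∀ (a b : R) (f : R[X]), b ≠ 0 → f.Monic → motive f →
      motive (((X - C a) ^ 2 + C (b ^ 2)) * f)) {f : R[X]} (hf : f.Monic) : motive f := by
  induction hn : f.natDegree using Nat.strong_induction_on generalizing f with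
  | _ n ih =>
  by_cases h0 : n = 0
  · rw [eq_one_of_monic_natDegree_zero hf (hn.trans h0)]; exact one
  obtain ⟨z, hz⟩ := IsAlgClosed.exists_aeval_eq_zero (Complexification R) f
    (by rw [Ne, degree_eq_natDegree hf.ne_zero]; rw [hn]; exact_mod_cast h0)
  obtain ⟨a, b⟩ := z
  by_cases hb : b = 0
  · have hroot : f.IsRoot a := by
      subst hb
      have h1 : aeval (algebraMap R (Complexification R) a) f = 0 := hz
      rw [aeval_algebraMap_apply] at h1
      exact (map_eq_zero _).1 h1
    obtain ⟨g, hg⟩ := dvd_iff_isRoot.2 hroot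
    have hgm : g.Monic := (monic_X_sub_C a).of_mul_monic_left (hg ▸ hf)
    rw [hg]
    refine linear a g hgm (ih _ ?_ hgm rfl)
    rw [← hn, hg, (monic_X_sub_C a).natDegree_mul hgm, natDegree_X_sub_C]; omega
  · set q : R[X] := (X - C a) ^ 2 + C (b ^ 2) with hq
    have hqd : q.natDegree = 2 := by
      rw [hq]; compute_degree!
    have hqm : q.Monic := by
      rw [hq]; monicity!
    have hqz : aeval (⟨a, b⟩ : Complexification R) q = 0 := by
      rw [hq]
      ext <;> simp [pow_two, QuadraticAlgebra.algebraMap_eq]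
    have hdvd : q ∣ f := by
      rw [← modByMonic_eq_zero_iff_dvd hqm]
      have h1 : aeval (⟨a, b⟩ : Complexification R) (f %ₘ q) = 0 := by
        rw [modByMonic_eq_sub_mul_div f q]; simp [hz, hqz]
      have h2 : (f %ₘ q).natDegree < 2 := by
        rw [← hqd]
        exact natDegree_modByMonic_lt f hqm (by rintro h; rw [h] at hqd; simp at hqd)
      have h3 := eq_X_add_C_of_natDegree_le_one (Nat.le_of_lt_succ h2)
      rw [h3] at h1
      have him := congrArg QuadraticAlgebra.im h1
      have hre := congrArg QuadraticAlgebra.re h1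
      simp [QuadraticAlgebra.algebraMap_eq] at him hre
      have h4 : (f %ₘ q).coeff 1 = 0 := him.resolve_right hb
      rw [h4] at hre h3
      rw [zero_mul, zero_add] at hre
      rw [h3, hre]; simp
    obtain ⟨g, hg⟩ := hdvd
    have hgm : g.Monic := hqm.of_mul_monic_left (hg ▸ hf)
    rw [hg]
    refine quadratic a b g hb hgm (ih _ ?_ hgm rfl)
    rw [← hn, hg, hqm.natDegree_mul hgm, hqd]; omega

/-! ### Intermediate values, Rolle and Thom's lemma over a real closed field -/

section RealClosedCalculus

variable {R : Type*} [Field R] [LinearOrder R] [IsStrictOrderedRing R] [IsRealClosed R]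

/-- Quadratic factors are positive everywhere, and a linear factor with root outside `[a, b]` has
the same sign at both ends. -/
theorem Polynomial.eval_mul_eval_pos_of_forall_not_isRoot {f : R[X]} {a b : R} (hab : a ≤ b)
    (h : ∀ x, a ≤ x → x ≤ b → ¬ f.IsRoot x) : 0 < f.eval a * f.eval b := by
  have hf : f ≠ 0 := by
    rintro rfl; exact h a le_rfl hab (by simp)
  have key : ∀ g : R[X], g.Monic → (∀ x, a ≤ x → x ≤ b → ¬ g.IsRoot x) →
      0 < g.eval a * g.eval b := by
    intro g hg
    refine hg.induction_realClosed (motive := fun g => (∀ x, a ≤ x → x ≤ b → ¬ g.IsRoot x) →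
      0 < g.eval a * g.eval b) (fun _ => by simp) ?_ ?_
    · intro r g _ ih hroot
      have h1 := ih fun x hx hx' hr => hroot x hx hx' (by simp [hr.eq_zero])
      have h2 : 0 < (a - r) * (b - r) := by
        rcases lt_or_ge r a with hr | hr
        · exact mul_pos (by linarith) (by linarith)
        rcases lt_or_ge b r with hr' | hr'
        · exact mul_pos_of_neg_of_neg (by linarith) (by linarith)
        · exact absurd (by simp) (hroot r hr hr')
      have := mul_pos h2 h1
      simp only [eval_mul, eval_sub, eval_X, eval_C]
      linarith
    · intro c d g hd _ ih hroot
      have h1 := ih fun x hx hx' hr => hroot x hx hx' (by simp [hr.eq_zero])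
      have hq : ∀ x : R, 0 < (x - c) ^ 2 + d ^ 2 := fun x => by positivity
      have := mul_pos (mul_pos (hq a) (hq b)) h1
      simp only [eval_mul, eval_sub, eval_X, eval_C, eval_add, eval_pow]
      linarith
  have hl : f.leadingCoeff ≠ 0 := leadingCoeff_ne_zero.2 hf
  -- Making `f` monic multiplies the product of the two values by a positive square.
  have h1 := key (f * C f.leadingCoeff⁻¹) (monic_mul_leadingCoeff_inv hf) fun x hx hx' hr =>
    h x hx hx' (by
      have := hr.eq_zero
      simpa [hf] using this)
  have h2 : 0 < f.leadingCoeff⁻¹ ^ 2 := by positivity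
  simp only [eval_mul, eval_C] at h1
  have h3 : f.eval a * f.leadingCoeff⁻¹ * (f.eval b * f.leadingCoeff⁻¹) =
    (f.eval a * f.eval b) * f.leadingCoeff⁻¹ ^ 2 := by ring
  rw [h3] at h1
  exact pos_of_mul_pos_left h1 h2.le

theorem Polynomial.exists_isRoot_of_eval_mul_eval_neg {f : R[X]} {a b : R} (hab : a ≤ b)
    (h : f.eval a * f.eval b < 0) : ∃ x, a < x ∧ x < b ∧ f.IsRoot x := by
  by_contra! hno
  refine absurd (eval_mul_eval_pos_of_forall_not_isRoot hab fun x hx hx' hr => ?_) h.not_gt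
  rcases hx.eq_or_lt with rfl | hx
  · rw [hr.eq_zero] at h; simp at h
  rcases hx'.eq_or_lt with rfl | hx'
  · rw [hr.eq_zero] at h; simp at h
  exact hno x hx hx' hr

theorem Polynomial.sign_eval_eq_of_forall_not_isRoot {f : R[X]} {a b : R} (hab : a ≤ b)
    (h : ∀ x, a ≤ x → x ≤ b → ¬ f.IsRoot x) :
    SignType.sign (f.eval a) = SignType.sign (f.eval b) := by
  rcases pos_and_pos_or_neg_and_neg_of_mul_pos (eval_mul_eval_pos_of_forall_not_isRoot hab h)
    with ⟨h1, h2⟩ | ⟨h1, h2⟩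
  · rw [sign_pos h1, sign_pos h2]
  · rw [sign_neg h1, sign_neg h2]

theorem Polynomial.Monic.sign_eval_of_forall_le_not_isRoot {f : R[X]} (hf : f.Monic) {y : R}
    (h : ∀ x, x ≤ y → ¬ f.IsRoot x) : SignType.sign (f.eval y) = (-1) ^ f.natDegree := by
  revert h
  refine hf.induction_realClosed (motive := fun f => (∀ x, x ≤ y → ¬ f.IsRoot x) →
    SignType.sign (f.eval y) = (-1) ^ f.natDegree) (fun _ => by simp) ?_ ?_
  · intro r g hg ih hroot
    have h1 := ih fun x hx hr => hroot x hx (by simp [hr.eq_zero])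
    have h2 : y < r := not_le.1 fun hr => hroot r hr (by simp)
    rw [eval_mul, sign_mul, h1, (monic_X_sub_C r).natDegree_mul hg, natDegree_X_sub_C, pow_add]
    simp [sign_neg (sub_neg.2 h2)]
  · intro c d g hd hg ih hroot
    have h1 := ih fun x hx hr => hroot x hx (by simp [hr.eq_zero])
    have hq : 0 < (y - c) ^ 2 + d ^ 2 := by positivity
    have hqm : ((X - C c) ^ 2 + C (d ^ 2)).Monic := by monicity!
    have hqd : ((X - C c) ^ 2 + C (d ^ 2)).natDegree = 2 := by compute_degree!
    rw [eval_mul, sign_mul, h1, hqm.natDegree_mul hg, hqd, pow_add]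
    simp [sign_pos hq]

/-- Write `f = (X - x) ^ m * g` with `g(x) ≠ 0`. To the right of `x` the power is positive and `g`
keeps its sign, while the `m`-th derivative at `x` is `m! * g(x)`. -/
theorem Polynomial.sign_eval_of_forall_Ioc_not_isRoot {f : R[X]} {x y : R} (hxy : x < y)
    (h : ∀ z, x < z → z ≤ y → ¬ f.IsRoot z) :
    SignType.sign (f.eval y) =
      SignType.sign ((derivative^[f.rootMultiplicity x] f).eval x) := by
  have hf : f ≠ 0 := by
    rintro rfl; exact h y hxy le_rfl (by simp)
  obtain ⟨g, hg, hgd⟩ := f.exists_eq_pow_rootMultiplicity_mul_and_not_dvd hf x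
  rw [eval_iterate_derivative_rootMultiplicity]
  set m := f.rootMultiplicity x
  have hdiv : f /ₘ (X - C x) ^ m = g := by
    conv_lhs => rw [hg]
    exact mul_divByMonic_cancel_left _ ((monic_X_sub_C x).pow m)
  have hgx : ¬ g.IsRoot x := fun hr => hgd (dvd_iff_isRoot.2 hr)
  have h1 : SignType.sign (g.eval x) = SignType.sign (g.eval y) := by
    refine sign_eval_eq_of_forall_not_isRoot hxy.le fun z hz hz' hr => ?_
    rcases hz.eq_or_lt with rfl | hz
    · exact hgx hr
    · refine h z hz hz' ?_
      rw [hg]; simp [hr.eq_zero]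
  rw [hdiv, nsmul_eq_mul, sign_mul, sign_pos (by positivity : (0 : R) < (m.factorial : R)), one_mul,
    h1]
  conv_lhs => rw [hg]
  rw [eval_mul, sign_mul, eval_pow, eval_sub, eval_X, eval_C,
    sign_pos (pow_pos (sub_pos.2 hxy) m), one_mul]

/-- Factoring out the full powers of `X - a` and `X - b` leaves a cofactor `g` of constant sign on
`[a, b]`. After removing the common powers, the derivative has values of opposite signs at `a` and
`b`. -/
theorem Polynomial.exists_isRoot_derivative_of_consecutive {f : R[X]} {a b : R} (hab : a < b)
    (hf : f ≠ 0) (ha : f.IsRoot a) (hb : f.IsRoot b)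
    (hno : ∀ x, a < x → x < b → ¬ f.IsRoot x) :
    ∃ c, a < c ∧ c < b ∧ (derivative f).IsRoot c := by
  obtain ⟨g₁, hg₁, hgd₁⟩ := f.exists_eq_pow_rootMultiplicity_mul_and_not_dvd hf a
  have hm := (rootMultiplicity_pos hf).2 ha
  set m := f.rootMultiplicity a
  have hg₁0 : g₁ ≠ 0 := by rintro rfl; simp at hgd₁
  have hb₁ : g₁.IsRoot b := by
    have := hb.eq_zero
    rw [hg₁, eval_mul] at this
    refine (mul_eq_zero.1 this).resolve_left ?_
    simpa using fun h => absurd h (sub_ne_zero.2 hab.ne')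
  obtain ⟨g, hg, hgd⟩ := g₁.exists_eq_pow_rootMultiplicity_mul_and_not_dvd hg₁0 b
  have hn := (rootMultiplicity_pos hg₁0).2 hb₁
  set n := g₁.rootMultiplicity b
  have hgab : 0 < g.eval a * g.eval b := by
    refine eval_mul_eval_pos_of_forall_not_isRoot hab.le fun x hx hx' hr => ?_
    rcases hx.eq_or_lt with rfl | hx
    · exact hgd₁ (dvd_iff_isRoot.2 (by rw [hg]; simp [hr.eq_zero]))
    rcases hx'.eq_or_lt with rfl | hx'
    · exact hgd (dvd_iff_isRoot.2 hr)
    · exact hno x hx hx' (by rw [hg₁, hg]; simp [hr.eq_zero])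
  obtain ⟨m, hm'⟩ : ∃ k, m = k + 1 := ⟨m - 1, by omega⟩
  obtain ⟨n, hn'⟩ : ∃ k, n = k + 1 := ⟨n - 1, by omega⟩
  rw [hm'] at hg₁
  rw [hn'] at hg
  set h : R[X] := ((m + 1 : ℕ) : R[X]) * (X - C b) * g + ((n + 1 : ℕ) : R[X]) * (X - C a) * g +
    (X - C a) * (X - C b) * derivative g with hh
  have hder : derivative f = (X - C a) ^ m * (X - C b) ^ n * h := by
    rw [hg₁, hg, hh]
    simp only [derivative_mul, derivative_pow, derivative_sub, derivative_X, derivative_C,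
      Nat.add_sub_cancel, sub_zero, mul_one, map_natCast]
    ring
  have hneg : h.eval a * h.eval b < 0 := by
    have h1 : h.eval a * h.eval b =
        -((m + 1 : ℕ) * (n + 1 : ℕ) * (b - a) ^ 2 * (g.eval a * g.eval b)) := by
      rw [hh]
      simp only [eval_add, eval_mul, eval_natCast, eval_sub, eval_X, eval_C]
      ring
    rw [h1, neg_lt_zero]
    have : 0 < b - a := sub_pos.2 hab
    positivity
  obtain ⟨c, hc, hc', hr⟩ := exists_isRoot_of_eval_mul_eval_neg hab.le hneg
  exact ⟨c, hc, hc', by rw [hder]; simp [hr.eq_zero]⟩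

theorem Polynomial.exists_isRoot_derivative {f : R[X]} {a b : R} (hab : a < b)
    (h : f.eval a = f.eval b) : ∃ c, a < c ∧ c < b ∧ (derivative f).IsRoot c := by
  set f₀ := f - C (f.eval a) with hf₀
  have hd : derivative f₀ = derivative f := by simp [hf₀]
  have ha : f₀.IsRoot a := by simp [hf₀]
  have hb : f₀.IsRoot b := by simp [hf₀, h]
  by_cases h0 : f₀ = 0
  · obtain ⟨c, hc, hc'⟩ := exists_between hab
    exact ⟨c, hc, hc', by rw [← hd, h0]; simp⟩
  -- The smallest root of `f₀` beyond `a` is consecutive to `a`.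
  let S := f₀.roots.toFinset.filter (a < ·)
  have hbS : b ∈ S := by simp [S, h0, hab, hb.eq_zero]
  let b' := S.min' ⟨b, hbS⟩
  have hb' : b' ∈ S := S.min'_mem _
  have hbb' : b' ≤ b := S.min'_le _ hbS
  simp only [S, Finset.mem_filter, Multiset.mem_toFinset, mem_roots h0] at hb'
  obtain ⟨c, hc, hc', hr⟩ := exists_isRoot_derivative_of_consecutive hb'.2 h0 ha hb'.1
    fun x hx hx' hr => hx'.not_ge (S.min'_le _ (by simp [S, h0, hx, hr.eq_zero]))
  exact ⟨c, hc, hc'.trans_le hbb', hd ▸ hr⟩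

theorem Polynomial.exists_eval_derivative_mul_eq {f : R[X]} {a b : R} (hab : a < b) :
    ∃ c, a < c ∧ c < b ∧ (derivative f).eval c * (b - a) = f.eval b - f.eval a := by
  obtain ⟨c, hc, hc', hr⟩ := exists_isRoot_derivative
    (f := C (b - a) * f - C (f.eval b - f.eval a) * X) hab (by simp; ring)
  refine ⟨c, hc, hc', ?_⟩
  have := hr.eq_zero
  simp at this
  linear_combination this

/-- A derivative of constant sign makes `f` monotone, so `f(x)` lies between two end values of the
same sign. -/
theorem Polynomial.sign_eval_eq_on_Icc_of_derivative {f : R[X]} {a b : R} {s : SignType}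
    (hs : SignType.sign (f.eval a) = s) (hs' : SignType.sign (f.eval b) = s) {t : SignType}
    (hd : ∀ x, a ≤ x → x ≤ b → SignType.sign ((derivative f).eval x) = t) :
    ∀ x, a ≤ x → x ≤ b → SignType.sign (f.eval x) = s := by
  intro x hx hx'
  rcases hx.eq_or_lt with rfl | hx
  · exact hs
  rcases hx'.eq_or_lt with rfl | hx'
  · exact hs'
  obtain ⟨c, hc, hc', h1⟩ := exists_eval_derivative_mul_eq (f := f) hx
  obtain ⟨d, hd1, hd2, h2⟩ := exists_eval_derivative_mul_eq (f := f) hx'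
  have hcs := hd c hc.le (hc'.trans hx').le
  have hds := hd d (hx.trans hd1).le hd2.le
  have hmono : (f.eval a ≤ f.eval x ∧ f.eval x ≤ f.eval b) ∨
      (f.eval b ≤ f.eval x ∧ f.eval x ≤ f.eval a) := by
    have e1 : 0 < x - a := sub_pos.2 hx
    have e2 : 0 < b - x := sub_pos.2 hx'
    rcases le_total 0 ((derivative f).eval c) with h | h
    · left
      have h' : 0 ≤ (derivative f).eval d := by
        rw [← sign_nonneg_iff, hds, ← hcs, sign_nonneg_iff]; exact h
      constructor
      · nlinarith [mul_nonneg h e1.le]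
      · nlinarith [mul_nonneg h' e2.le]
    · right
      have h' : (derivative f).eval d ≤ 0 := by
        rw [← sign_nonpos_iff, hds, ← hcs, sign_nonpos_iff]; exact h
      constructor
      · nlinarith [mul_nonneg (neg_nonneg.2 h') e2.le]
      · nlinarith [mul_nonneg (neg_nonneg.2 h) e1.le]
  have hms : Monotone (SignType.sign : R → SignType) := SignType.sign.monotone
  rcases hmono with ⟨h3, h4⟩ | ⟨h3, h4⟩
  · exact le_antisymm (hs' ▸ hms h4) (hs ▸ hms h3)
  · exact le_antisymm (hs ▸ hms h4) (hs' ▸ hms h3)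

/-- Thom's lemma: a root of a polynomial is determined by the signs of the derivatives. -/
theorem Polynomial.Monic.eq_of_sign_iterate_derivative_eq {f : R[X]} (hf : f.Monic) {a b : R}
    (ha : f.IsRoot a) (hb : f.IsRoot b)
    (h : ∀ k, 1 ≤ k → k ≤ f.natDegree - 1 →
      SignType.sign ((derivative^[k] f).eval a) = SignType.sign ((derivative^[k] f).eval b)) :
    a = b := by
  wlog hab : a < b generalizing a b
  · rcases lt_trichotomy a b with h' | h' | h'
    · exact absurd h' hab
    · exact h'
    · exact (this hb ha (fun k hk hk' => (h k hk hk').symm) h').symm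
  exfalso
  have hn : f.natDegree ≠ 0 := by
    intro h0
    rw [eq_one_of_monic_natDegree_zero hf h0] at ha
    simp at ha
  -- Descend from the constant top derivative: each derivative in turn has constant sign on `[a,
  -- b]`. At order 0 this sign is 0, so `f` vanishes on an infinite interval.
  have key : ∀ j, j ≤ f.natDegree → ∀ x, a ≤ x → x ≤ b →
      SignType.sign ((derivative^[f.natDegree - j] f).eval x) =
        SignType.sign ((derivative^[f.natDegree - j] f).eval a) := by
    intro j
    induction j with
    | zero =>
      intro _ x _ _
      have h1 : (derivative^[f.natDegree] f).natDegree ≤ 0 := by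
        simpa using natDegree_iterate_derivative f f.natDegree
      rw [Nat.sub_zero, eq_C_of_natDegree_le_zero h1]; simp
    | succ j ih =>
      intro hj
      have hd : derivative (derivative^[f.natDegree - (j + 1)] f) =
          derivative^[f.natDegree - j] f := by
        rw [← Function.iterate_succ_apply' (f := derivative)]
        congr 2; omega
      refine sign_eval_eq_on_Icc_of_derivative rfl ?_ (fun x hx hx' => ?_)
        (t := SignType.sign ((derivative^[f.natDegree - j] f).eval a))
      · rcases Nat.eq_zero_or_pos (f.natDegree - (j + 1)) with h0 | h0
        · rw [h0]; simp [ha.eq_zero, hb.eq_zero]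
        · exact (h _ h0 (by omega)).symm
      · rw [hd]; exact ih (by omega) x hx hx'
  have h0 := key f.natDegree le_rfl
  simp only [Nat.sub_self, Function.iterate_zero, id_eq, ha.eq_zero, sign_zero, sign_eq_zero_iff]
    at h0
  refine hf.ne_zero (eq_zero_of_infinite_isRoot f ((Set.Icc_infinite hab).mono ?_))
  exact fun x hx => h0 x hx.1 hx.2

end RealClosedCalculus

/-! ### Hankel determinants and orthogonal polynomials -/

section Hankel

variable {R : Type*}

/-- The determinant of the `n × n` Hankel matrix of the moments of a linear functional. -/
noncomputable def hankelDet [CommRing R] (L : R[X] →ₗ[R] R) (n : ℕ) : R :=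
  (Matrix.of fun i j : Fin n => L (X ^ ((i : ℕ) + (j : ℕ)))).det

/-- The sign of the permutation of `Fin n` that reverses the order. -/
def revSign (n : ℕ) : ℤˣ := Equiv.Perm.sign (Fin.revPerm : Equiv.Perm (Fin n))

theorem hankelDet_zero [CommRing R] (L : R[X] →ₗ[R] R) : hankelDet L 0 = 1 := by
  simp [hankelDet]

theorem hankelDet_neg [CommRing R] (L : R[X] →ₗ[R] R) (n : ℕ) :
    hankelDet (-L) n = (-1) ^ n * hankelDet L n := by
  have : (Matrix.of fun i j : Fin n => (-L) (X ^ ((i : ℕ) + (j : ℕ)))) =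
      -(Matrix.of fun i j : Fin n => L (X ^ ((i : ℕ) + (j : ℕ)))) := by
    ext i j; simp
  rw [hankelDet, this, Matrix.det_neg, hankelDet, Fintype.card_fin]

theorem LinearMap.map_mul_eq_sum_coeff [CommRing R] (L : R[X] →ₗ[R] R) (q : R[X]) {g : R[X]}
    {N : ℕ} (hg : g.natDegree < N) :
    L (q * g) = ∑ k ∈ Finset.range N, g.coeff k * L (q * X ^ k) := by
  conv_lhs => rw [g.as_sum_range' N hg, Finset.mul_sum, map_sum]
  refine Finset.sum_congr rfl fun k _ => ?_
  rw [← C_mul_X_pow_eq_monomial, mul_left_comm, C_mul', map_smul, smul_eq_mul]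

theorem LinearMap.map_mul_eq_zero_of_natDegree_lt [CommRing R] {L : R[X] →ₗ[R] R} {q g : R[X]}
    {N : ℕ} (hq : ∀ j < N, L (q * X ^ j) = 0) (hg : g.natDegree < N) : L (q * g) = 0 := by
  rw [L.map_mul_eq_sum_coeff q hg]
  exact Finset.sum_eq_zero fun k hk => by rw [hq k (Finset.mem_range.1 hk), mul_zero]

/-- Passing from the rows of `X ^ i` to those of monic `u i` of degree `i` is a unitriangular change
of basis. -/
theorem hankelDet_eq_det_of_monic [CommRing R] (L : R[X] →ₗ[R] R) {n : ℕ} (u : Fin n → R[X])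
    (hu : ∀ i, (u i).Monic) (hdeg : ∀ i, (u i).natDegree = i) :
    hankelDet L n = (Matrix.of fun i j : Fin n => L (u i * X ^ (j : ℕ))).det := by
  have h1 : (Matrix.of fun i j : Fin n => L (u i * X ^ (j : ℕ))) =
      (Matrix.of fun i j : Fin n => (u j).coeff i).transpose *
        Matrix.of fun i j : Fin n => L (X ^ ((i : ℕ) + (j : ℕ))) := by
    ext i j
    rw [Matrix.mul_apply, Matrix.of_apply, mul_comm,
      L.map_mul_eq_sum_coeff _ (N := n) (by rw [hdeg]; exact i.2), Finset.sum_range]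
    refine Finset.sum_congr rfl fun k _ => ?_
    simp only [Matrix.transpose_apply, Matrix.of_apply]
    rw [← pow_add, add_comm]
  rw [h1, Matrix.det_mul, Matrix.det_transpose, Matrix.det_matrixOfPolynomials u hdeg hu, one_mul,
    hankelDet]

/-- Reversing the columns makes the matrix lower triangular with constant diagonal `c`. -/
theorem Matrix.det_of_antitriangular [CommRing R] {e : ℕ} {c : R}
    (M : Matrix (Fin (e + 1)) (Fin (e + 1)) R)
    (h0 : ∀ i j : Fin (e + 1), (i : ℕ) + (j : ℕ) < e → M i j = 0)
    (hc : ∀ i j : Fin (e + 1), (i : ℕ) + (j : ℕ) = e → M i j = c) :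
    M.det = (revSign (e + 1) : ℤ) * c ^ (e + 1) := by
  have h1 := Matrix.det_permute' (Fin.revPerm : Equiv.Perm (Fin (e + 1))) M
  have h2 : (M.submatrix id (Fin.revPerm : Equiv.Perm (Fin (e + 1)))).det = c ^ (e + 1) := by
    rw [Matrix.det_of_isLowerTriangular]
    · rw [Finset.prod_congr rfl (g := fun _ => c), Finset.prod_const, Finset.card_univ,
        Fintype.card_fin]
      intro i _
      refine hc _ _ ?_
      have := i.2
      simp only [id, Fin.revPerm_apply, Fin.val_rev]; omega
    · intro i j hij
      refine h0 _ _ ?_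
      have hi := i.2
      have hj := j.2
      have : (i : ℕ) < j := hij
      simp only [id, Fin.revPerm_apply, Fin.val_rev]; omega
  rw [h2] at h1
  rw [h1, ← mul_assoc, ← Int.cast_mul, revSign]
  simp

/-- In the basis `1, …, X ^ (n - 1), q, q X, …, q X ^ e` for the rows, the matrix is block
triangular. The last block is antitriangular with `L (q * X ^ (n + e))` on the antidiagonal. -/
theorem hankelDet_add_succ [CommRing R] [Nontrivial R] (L : R[X] →ₗ[R] R) {n e : ℕ} {q : R[X]}
    (hq : q.Monic) (hqn : q.natDegree = n) (h : ∀ j < n + e, L (q * X ^ j) = 0) :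
    hankelDet L (n + (e + 1)) =
      hankelDet L n * ((revSign (e + 1) : ℤ) * L (q * X ^ (n + e)) ^ (e + 1)) := by
  have hxm : ∀ k, (X ^ k : R[X]).Monic := fun k => monic_X_pow k
  rw [hankelDet_eq_det_of_monic L (n := n + (e + 1))
    (fun i => if (i : ℕ) < n then X ^ (i : ℕ) else q * X ^ ((i : ℕ) - n))
    (fun i => by split_ifs; exacts [hxm _, hq.mul (hxm _)])
    (fun i => by
      split_ifs with hi
      · exact natDegree_X_pow _
      · rw [hq.natDegree_mul (hxm _), hqn, natDegree_X_pow]; omega),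
    ← Matrix.det_submatrix_equiv_self (finSumFinEquiv (m := n) (n := e + 1)),
    ← Matrix.fromBlocks_toBlocks (Matrix.submatrix _ _ _)]
  have hz : (Matrix.submatrix (Matrix.of fun i j : Fin (n + (e + 1)) =>
      L ((if (i : ℕ) < n then X ^ (i : ℕ) else q * X ^ ((i : ℕ) - n)) * X ^ (j : ℕ)))
      (finSumFinEquiv (m := n) (n := e + 1)) finSumFinEquiv).toBlocks₂₁ = 0 := by
    ext i j
    have hi := i.2
    have hj := j.2
    simp only [Matrix.toBlocks₂₁, Matrix.submatrix_apply, Matrix.of_apply,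
      finSumFinEquiv_apply_right, finSumFinEquiv_apply_left, Fin.val_natAdd, Fin.val_castAdd,
      Matrix.zero_apply]
    rw [if_neg (by omega), mul_assoc, ← pow_add]
    exact h _ (by omega)
  rw [hz, Matrix.det_fromBlocks_zero₂₁]
  congr 1
  · rw [hankelDet]
    congr 1
    ext i j
    simp [Matrix.toBlocks₁₁, pow_add]
  · refine Matrix.det_of_antitriangular _ ?_ ?_
    · intro i j hij
      simp only [Matrix.toBlocks₂₂, Matrix.submatrix_apply, Matrix.of_apply,
        finSumFinEquiv_apply_right, Fin.val_natAdd]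
      rw [if_neg (by omega), mul_assoc, ← pow_add]
      exact h _ (by omega)
    · intro i j hij
      simp only [Matrix.toBlocks₂₂, Matrix.submatrix_apply, Matrix.of_apply,
        finSumFinEquiv_apply_right, Fin.val_natAdd]
      rw [if_neg (by omega), mul_assoc, ← pow_add]
      congr 3; omega

theorem eq_zero_of_hankelDet_ne_zero [Field R] {L : R[X] →ₗ[R] R} {n : ℕ}
    (hn : hankelDet L n ≠ 0) {f : R[X]} (hf : f.degree < n) (h : ∀ j < n, L (f * X ^ j) = 0) :
    f = 0 := by
  by_contra hf0
  have hfn : f.natDegree < n := (natDegree_lt_iff_degree_lt hf0).2 hf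
  have h1 : (fun k : Fin n => f.coeff k) = 0 := by
    refine Matrix.eq_zero_of_mulVec_eq_zero hn ?_
    ext j
    have := h j j.2
    rw [mul_comm, L.map_mul_eq_sum_coeff _ hfn, Finset.sum_range] at this
    simp only [Matrix.mulVec, dotProduct, Matrix.of_apply, Pi.zero_apply, pow_add]
    rw [← this]
    exact Finset.sum_congr rfl fun k _ => mul_comm _ _
  exact hf0 (leadingCoeff_eq_zero.1 (congrFun h1 ⟨f.natDegree, hfn⟩))

/-- The lower coefficients of `q` solve a linear system whose matrix is the invertible Hankel
matrix. -/
theorem exists_monic_orthogonal [Field R] {L : R[X] →ₗ[R] R} {n : ℕ} (hn : hankelDet L n ≠ 0) :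
    ∃ q : R[X], q.Monic ∧ q.natDegree = n ∧ ∀ j < n, L (q * X ^ j) = 0 := by
  have hu : IsUnit (Matrix.of fun i j : Fin n => L (X ^ ((i : ℕ) + (j : ℕ)))) :=
    (Matrix.isUnit_iff_isUnit_det _).2 (isUnit_iff_ne_zero.2 hn)
  obtain ⟨v, hv⟩ := Matrix.mulVec_surjective_iff_isUnit.2 hu fun j : Fin n => -L (X ^ (n + j))
  have hdeg : (∑ k : Fin n, C (v k) * X ^ (k : ℕ)).degree < (n : WithBot ℕ) :=
    degree_sum_fin_lt v
  refine ⟨X ^ n + ∑ k : Fin n, C (v k) * X ^ (k : ℕ), monic_X_pow_add hdeg,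
    natDegree_eq_of_degree_eq_some (by rw [degree_add_eq_left_of_degree_lt (by simpa using hdeg)];
                                       simp), fun j hj => ?_⟩
  have h1 := congrFun hv ⟨j, hj⟩
  simp only [Matrix.mulVec, dotProduct, Matrix.of_apply] at h1
  rw [add_mul, map_add, ← pow_add, Finset.sum_mul, map_sum, ← neg_neg (L (X ^ (n + j))), ← h1,
    neg_add_eq_zero]
  refine Finset.sum_congr rfl fun k _ => ?_
  rw [mul_assoc, ← pow_add, C_mul', map_smul, smul_eq_mul, mul_comm, add_comm j]

/-- By `hankelDet_add_succ`, each vanishing minor after a nonzero one forces one more value `L (q *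
X ^ j)` to vanish. -/
theorem map_mul_X_pow_eq_zero_of_hankelDet [Field R] {L : R[X] →ₗ[R] R} {n : ℕ}
    (hn : hankelDet L n ≠ 0) {q : R[X]} (hq : q.Monic) (hqn : q.natDegree = n)
    (h : ∀ j < n, L (q * X ^ j) = 0) (e : ℕ)
    (hz : ∀ m, n < m → m ≤ n + e → hankelDet L m = 0) : ∀ j < n + e, L (q * X ^ j) = 0 := by
  induction e with
  | zero => exact h
  | succ e ih =>
    have ih' := ih fun m hm hm' => hz m hm (by omega)
    intro j hj
    rcases Nat.lt_succ_iff_lt_or_eq.1 (show j < (n + e) + 1 by omega) with hj | rfl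
    · exact ih' j hj
    · have h1 := hankelDet_add_succ L hq hqn ih'
      rw [hz _ (by omega) le_rfl, eq_comm] at h1
      have h2 : ((revSign (e + 1) : ℤ) : R) ≠ 0 := by
        rcases Int.units_eq_one_or (revSign (e + 1)) with h | h <;> simp [h]
      have h3 := (mul_eq_zero.1 ((mul_eq_zero.1 h1).resolve_left hn)).resolve_left h2
      exact eq_zero_of_pow_eq_zero h3

end Hankel

/-! ### The signature of a Hankel form from the signs of its minors -/

section Signature

variable {R : Type*} [Field R]

/-- An antitriangular block of size `e + 1` with antidiagonal sign `μ` has signature 0 or `μ`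
according to parity. The isotropic vectors, of index `2 * i < e`, serve in both semidefinite
families; when `e` is even the middle one goes to the side chosen by `μ`. -/
theorem exists_block_sizes (e : ℕ) {μ : SignType} (hμ : μ ≠ 0) :
    ∃ a b : ℕ, a + b = e + 1 ∧ (∀ i < a, 2 * i < e ∨ 2 * i = e ∧ μ = 1) ∧
      ∀ i < b, 2 * i < e ∨ 2 * i = e ∧ μ = -1 := by
  rcases Nat.even_or_odd' e with ⟨k, rfl | rfl⟩
  · cases μ with
    | zero => exact absurd rfl hμ
    | pos => exact ⟨k + 1, k, by omega, fun i hi => by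
        rcases Nat.lt_succ_iff_lt_or_eq.1 hi with h | h
        · left; omega
        · right; exact ⟨by omega, rfl⟩, fun i hi => by left; omega⟩
    | neg => exact ⟨k, k + 1, by omega, fun i hi => by left; omega, fun i hi => by
        rcases Nat.lt_succ_iff_lt_or_eq.1 hi with h | h
        · left; omega
        · right; exact ⟨by omega, rfl⟩⟩
  · exact ⟨k + 1, k + 1, by omega, fun i hi => by left; omega, fun i hi => by left; omega⟩

/-- Extension of a diagonal family of polynomials of degree less than `n` by multiples of the monic
orthogonal polynomial of degree `n`. -/
theorem diagonal_extend {L : R[X] →ₗ[R] R} {n e a : ℕ} {q : R[X]} (hq : q.Monic)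
    (hqn : q.natDegree = n) (h : ∀ j < n + e, L (q * X ^ j) = 0) {S : Finset ℕ}
    (hS : S ⊆ Finset.range n) {u : ℕ → R[X]} (hdeg : ∀ s < n, (u s).natDegree = s)
    (horth : ∀ s ∈ S, ∀ t ∈ S, s ≠ t → L (u s * u t) = 0) {P : R → Prop}
    (hP : ∀ s ∈ S, P (L (u s * u s))) (hP0 : P 0)
    (ha : ∀ i < a, 2 * i < e ∨ 2 * i = e ∧ P (L (q * X ^ (n + e)))) :
    (∀ s ∈ S ∪ Finset.Ico n (n + a), ∀ t ∈ S ∪ Finset.Ico n (n + a), s ≠ t →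
      L ((if s < n then u s else q * X ^ (s - n)) *
        (if t < n then u t else q * X ^ (t - n))) = 0) ∧
    ∀ s ∈ S ∪ Finset.Ico n (n + a), P (L ((if s < n then u s else q * X ^ (s - n)) *
      (if s < n then u s else q * X ^ (s - n)))) := by
  have hXm : ∀ k, (X ^ k : R[X]).Monic := fun k => monic_X_pow k
  have hcross : ∀ s < n, ∀ i < a, L (q * X ^ i * u s) = 0 := by
    intro s hs i hi
    rw [mul_assoc]
    refine LinearMap.map_mul_eq_zero_of_natDegree_lt h ?_
    refine natDegree_mul_le.trans_lt ?_
    rw [natDegree_X_pow, hdeg s hs]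
    have := ha i hi
    omega
  have hblock : ∀ i j, i + j < e → L (q * X ^ i * (q * X ^ j)) = 0 := by
    intro i j hij
    rw [mul_assoc]
    refine LinearMap.map_mul_eq_zero_of_natDegree_lt h ?_
    rw [(hXm i).natDegree_mul (hq.mul (hXm j)), hq.natDegree_mul (hXm j), natDegree_X_pow,
      natDegree_X_pow, hqn]
    omega
  have hdiag : ∀ i, 2 * i = e → L (q * X ^ i * (q * X ^ i)) = L (q * X ^ (n + e)) := by
    intro i hi
    have h1 : q * X ^ i * (q * X ^ i) = q * (q * X ^ e) := by rw [← hi]; ring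
    have hm : (q * X ^ e).Monic := hq.mul (hXm e)
    have hd : (q * X ^ e).natDegree = n + e := by
      rw [hq.natDegree_mul (hXm e), natDegree_X_pow, hqn]
    -- Only the leading term of `q * X ^ e` pairs nontrivially with `q`.
    rw [h1, L.map_mul_eq_sum_coeff q (N := n + e + 1) (by omega), Finset.sum_range_succ,
      Finset.sum_eq_zero fun k hk => by rw [h k (Finset.mem_range.1 hk), mul_zero], ← hd,
      hm.coeff_natDegree, one_mul, zero_add]
  constructor
  · intro s hs t ht hst
    rw [Finset.mem_union, Finset.mem_Ico] at hs ht
    rcases hs with hs | hs <;> rcases ht with ht | ht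
    · rw [if_pos (Finset.mem_range.1 (hS hs)), if_pos (Finset.mem_range.1 (hS ht))]
      exact horth s hs t ht hst
    · rw [if_pos (Finset.mem_range.1 (hS hs)), if_neg (by omega), mul_comm]
      exact hcross s (Finset.mem_range.1 (hS hs)) _ (by omega)
    · rw [if_pos (Finset.mem_range.1 (hS ht)), if_neg (by omega)]
      exact hcross t (Finset.mem_range.1 (hS ht)) _ (by omega)
    · rw [if_neg (by omega), if_neg (by omega)]
      have h1 := ha (s - n) (by omega)
      have h2 := ha (t - n) (by omega)
      exact hblock _ _ (by omega)
  · intro s hs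
    rw [Finset.mem_union, Finset.mem_Ico] at hs
    rcases hs with hs | hs
    · rw [if_pos (Finset.mem_range.1 (hS hs))]
      exact hP s hs
    · rw [if_neg (by omega)]
      rcases ha (s - n) (by omega) with h1 | ⟨h1, h2⟩
      · rw [hblock _ _ (by omega)]; exact hP0
      · rw [hdiag _ h1]; exact h2

variable [LinearOrder R] [IsStrictOrderedRing R]

/-- The signs of the determinants `hankelDet L m`, for `m ≤ n`, determine the sizes of a positive
semidefinite and of a negative semidefinite diagonal family. -/
theorem exists_index_sets (σ : ℕ → SignType) (h0 : σ 0 ≠ 0) (n : ℕ) (hn : σ n ≠ 0) :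
    ∃ S T : Finset ℕ, S ⊆ Finset.range n ∧ T ⊆ Finset.range n ∧ S.card + T.card = n ∧
      ∀ L : R[X] →ₗ[R] R, (∀ m ≤ n, SignType.sign (hankelDet L m) = σ m) →
        ∃ u : ℕ → R[X], (∀ s < n, (u s).Monic) ∧ (∀ s < n, (u s).natDegree = s) ∧
          (∀ s ∈ S, ∀ t ∈ S, s ≠ t → L (u s * u t) = 0) ∧
          (∀ s ∈ S, 0 ≤ L (u s * u s)) ∧
          (∀ s ∈ T, ∀ t ∈ T, s ≠ t → L (u s * u t) = 0) ∧
          (∀ s ∈ T, L (u s * u s) ≤ 0) := by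
  induction n using Nat.strong_induction_on with
  | _ n ih =>
  rcases Nat.eq_zero_or_pos n with rfl | hpos
  · exact ⟨∅, ∅, by simp, by simp, by simp, fun L _ => ⟨fun _ => 1, by simp⟩⟩
  -- The recursion jumps over the gap of vanishing minors, back to the last nonzero one before `n`.
  obtain ⟨l, hl⟩ : ∃ l, l = Nat.findGreatest (fun m => σ m ≠ 0) (n - 1) := ⟨_, rfl⟩
  have hln : l ≤ n - 1 := hl ▸ Nat.findGreatest_le _
  have hσl : σ l ≠ 0 := hl ▸ Nat.findGreatest_spec (P := fun m => σ m ≠ 0) (Nat.zero_le (n - 1)) h0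
  have hbetween : ∀ m, l < m → m < n → σ m = 0 := fun m hm hm' =>
    not_not.1 (Nat.findGreatest_is_greatest (hl ▸ hm) (by omega))
  obtain ⟨e, rfl⟩ : ∃ e, n = l + (e + 1) := ⟨n - 1 - l, by omega⟩
  obtain ⟨S, T, hS, hT, hcard, hST⟩ := ih l (by omega) hσl
  set ρ : SignType := SignType.sign ((revSign (e + 1) : ℤ) : R) with hρ
  have hρ0 : ρ ≠ 0 := by
    rw [hρ]
    rcases Int.units_eq_one_or (revSign (e + 1)) with h | h <;> simp [h]
  -- For `e` even, this product is the sign of the antidiagonal entry, by `hankelDet_add_succ`; for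
  -- `e` odd its value is irrelevant.
  obtain ⟨a, b, hab, ha, hb⟩ := exists_block_sizes e
    (mul_ne_zero (mul_ne_zero hn hσl) hρ0)
  have hdisj : ∀ {U : Finset ℕ} (c : ℕ), U ⊆ Finset.range l →
      (U ∪ Finset.Ico l (l + c)).card = U.card + c := by
    intro U c hU
    rw [Finset.card_union_of_disjoint, Nat.card_Ico, Nat.add_sub_cancel_left]
    rw [Finset.disjoint_left]
    intro s hs hs'
    have h1 := Finset.mem_range.1 (hU hs)
    have h2 := Finset.mem_Ico.1 hs'
    omega
  have hsub : ∀ {U : Finset ℕ} (c : ℕ), c ≤ e + 1 → U ⊆ Finset.range l →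
      U ∪ Finset.Ico l (l + c) ⊆ Finset.range (l + (e + 1)) := by
    intro U c hc hU s hs
    rw [Finset.mem_union, Finset.mem_Ico] at hs
    rw [Finset.mem_range]
    rcases hs with hs | hs
    · have := Finset.mem_range.1 (hU hs); omega
    · omega
  refine ⟨S ∪ Finset.Ico l (l + a), T ∪ Finset.Ico l (l + b), hsub a (by omega) hS,
    hsub b (by omega) hT, by rw [hdisj a hS, hdisj b hT]; omega, fun L hL => ?_⟩
  obtain ⟨u, hum, hud, hSo, hSp, hTo, hTp⟩ := hST L fun m hm => hL m (by omega)
  have hDl : hankelDet L l ≠ 0 := by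
    rw [← sign_ne_zero, hL l (by omega)]; exact hσl
  obtain ⟨q, hq, hqn, hq0⟩ := exists_monic_orthogonal hDl
  have hq1 := map_mul_X_pow_eq_zero_of_hankelDet hDl hq hqn hq0 e fun m hm hm' => by
    rw [← sign_eq_zero_iff, hL m (by omega)]; exact hbetween m hm (by omega)
  have hdet := congrArg SignType.sign (hankelDet_add_succ L hq hqn hq1)
  rw [hL _ le_rfl, sign_mul, sign_mul, hL l (by omega), sign_pow, ← hρ] at hdet
  have hsign : 2 ∣ e → SignType.sign (L (q * X ^ (l + e))) = σ (l + (e + 1)) * σ l * ρ := by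
    rintro ⟨k, rfl⟩
    have hodd : ∀ s : SignType, s ^ (2 * k + 1) = s := fun s => by
      rcases eq_or_ne s 0 with rfl | hs
      · simp
      · rw [pow_succ, pow_mul, (show ∀ s : SignType, s ≠ 0 → s ^ 2 = 1 by decide) s hs, one_pow,
          one_mul]
    rw [hodd] at hdet
    rw [hdet]
    exact (show ∀ a b c : SignType, a ≠ 0 → b ≠ 0 → c = a * (b * c) * a * b by decide) _ _ _
      hσl hρ0
  have hA := diagonal_extend hq hqn hq1 hS hud hSo (P := fun x => 0 ≤ x) hSp le_rfl
    (a := a) fun i hi => (ha i hi).imp_right fun h => ⟨h.1, by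
      rw [← sign_nonneg_iff, hsign ⟨i, h.1.symm⟩, h.2]; decide⟩
  have hB := diagonal_extend hq hqn hq1 hT hud hTo (P := fun x => x ≤ 0) hTp le_rfl
    (a := b) fun i hi => (hb i hi).imp_right fun h => ⟨h.1, by
      rw [← sign_nonpos_iff, hsign ⟨i, h.1.symm⟩, h.2]; decide⟩
  refine ⟨fun s => if s < l then u s else q * X ^ (s - l), fun s hs => ?_, fun s hs => ?_,
    hA.1, hA.2, hB.1, hB.2⟩
  · dsimp only
    split_ifs with h
    · exact hum s h
    · exact hq.mul (monic_X_pow _)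
  · dsimp only
    split_ifs with h
    · exact hud s h
    · rw [hq.natDegree_mul (monic_X_pow _), natDegree_X_pow, hqn]; omega

/-- Inertia argument: if `S` were larger than `I`, some nonzero `f` in the span of the `u s` would
be killed by every `φ i`. Then `L (f * f)` is both nonnegative and nonpositive, every `ψ j` kills
`f` too, and `f` lies in the radical, against the nonzero determinant. -/
theorem card_le_card_of_forall_map_mul_self_eq {I J : Type*} [Fintype I] [Fintype J]
    {L : R[X] →ₗ[R] R} {φ : I → R[X] →ₗ[R] R} {ψ : J → R[X] →ₗ[R] R} {c : I → R} {d : J → R}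
    (hd : ∀ j, 0 < d j)
    (hL : ∀ f, L (f * f) = ∑ i, c i * φ i f ^ 2 - ∑ j, d j * ψ j f ^ 2) {n : ℕ}
    (hn : hankelDet L n ≠ 0) {S : Finset ℕ} (hS : S ⊆ Finset.range n) {u : ℕ → R[X]}
    (hum : ∀ s < n, (u s).Monic) (hud : ∀ s < n, (u s).natDegree = s)
    (horth : ∀ s ∈ S, ∀ t ∈ S, s ≠ t → L (u s * u t) = 0)
    (hpos : ∀ s ∈ S, 0 ≤ L (u s * u s)) : S.card ≤ Fintype.card I := by
  by_contra! hlt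
  have hSn : ∀ s : S, (s : ℕ) < n := fun s => Finset.mem_range.1 (hS s.2)
  let comb : (S → R) →ₗ[R] R[X] := Fintype.linearCombination R fun s : S => u s
  have hcomb : ∀ x, comb x = ∑ s : S, x s • u s := fun x => Fintype.linearCombination_apply R _ x
  have hker := LinearMap.ker_ne_bot_of_finrank_lt (f := (LinearMap.pi φ).comp comb)
    (by simpa using hlt)
  obtain ⟨x, hx, hx0⟩ := (Submodule.ne_bot_iff _).1 hker
  have hli : LinearIndependent R fun s : S => u s := by
    let U : Polynomial.Sequence R :=
      { elems' := fun i => if i < n then u i else X ^ i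
        degree_eq' := fun i => by
          split_ifs with hi
          · rw [degree_eq_natDegree (hum i hi).ne_zero, hud i hi]
          · exact degree_X_pow i }
    have h1 : (fun s : S => u s) = (U : ℕ → R[X]) ∘ fun s : S => (s : ℕ) :=
      funext fun s => (if_pos (hSn s)).symm
    rw [h1]
    exact U.linearIndependent.comp _ Subtype.val_injective
  have hf0 : comb x ≠ 0 := by
    intro h
    rw [hcomb] at h
    exact hx0 (funext fun s => Fintype.linearIndependent_iff.1 hli x h s)
  set f := comb x
  have hφ : ∀ i, φ i f = 0 := fun i => congrFun (LinearMap.mem_ker.1 hx) i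
  have hfpos : 0 ≤ L (f * f) := by
    have h1 : L (f * f) = ∑ s : S, x s ^ 2 * L (u s * u s) := by
      rw [show f = ∑ s : S, x s • u s from hcomb x, Finset.sum_mul_sum, map_sum]
      refine Finset.sum_congr rfl fun s _ => ?_
      rw [map_sum, Finset.sum_eq_single s]
      · rw [smul_mul_smul_comm, map_smul, smul_eq_mul, sq]
      · intro t _ hts
        rw [smul_mul_smul_comm, map_smul, horth s s.2 t t.2 (fun h => hts (Subtype.ext h.symm)),
          smul_zero]
      · intro h; exact absurd (Finset.mem_univ _) h
    rw [h1]
    exact Finset.sum_nonneg fun s _ => mul_nonneg (sq_nonneg _) (hpos s s.2)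
  have hψ : ∀ j, ψ j f = 0 := by
    have h1 := hL f
    rw [Finset.sum_eq_zero fun i _ => by rw [hφ i]; ring, zero_sub] at h1
    have h2 : ∀ j ∈ Finset.univ, 0 ≤ d j * ψ j f ^ 2 := fun j _ =>
      mul_nonneg (hd j).le (sq_nonneg _)
    have h3 : ∑ j, d j * ψ j f ^ 2 = 0 :=
      le_antisymm (by linarith) (Finset.sum_nonneg h2)
    intro j
    have h4 := (Finset.sum_eq_zero_iff_of_nonneg h2).1 h3 j (Finset.mem_univ _)
    exact eq_zero_of_pow_eq_zero ((mul_eq_zero.1 h4).resolve_left (hd j).ne')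
  have hfg : ∀ g, L (f * g) = 0 := by
    intro g
    have h1 := hL (f + g)
    have h2 := hL g
    have h3 := hL f
    simp only [map_add, hφ, hψ, zero_add] at h1 h3
    have h4 : (f + g) * (f + g) = f * f + (2 : R) • (f * g) + g * g := by
      rw [smul_eq_C_mul, C_ofNat]; ring
    rw [h4, map_add, map_add, map_smul, smul_eq_mul] at h1
    simp at h3
    linarith
  refine hf0 (eq_zero_of_hankelDet_ne_zero hn ?_ fun j _ => hfg _)
  rw [show f = ∑ s : S, x s • u s from hcomb x]
  refine mem_degreeLT.1 (Submodule.sum_mem _ fun s _ => Submodule.smul_mem _ _ ?_)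
  rw [mem_degreeLT, degree_eq_natDegree (hum s (hSn s)).ne_zero, hud s (hSn s)]
  exact_mod_cast hSn s

end Signature

/-! ### Traces on `A[y] / (P)`: specialization and roots -/

section TraceFormula

theorem AdjoinRoot.trace_mk_eq_sum_coeff {A : Type*} [CommRing A] {P : A[X]} (hP : P.Monic)
    (f : A[X]) : Algebra.trace A (AdjoinRoot P) (AdjoinRoot.mk P f) =
      ∑ i ∈ Finset.range P.natDegree, ((f * X ^ i) %ₘ P).coeff i := by
  rw [Algebra.trace_eq_matrix_trace (AdjoinRoot.powerBasisAux' hP), Matrix.trace, Finset.sum_range]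
  refine Finset.sum_congr rfl fun i _ => ?_
  rw [Matrix.diag_apply, Algebra.leftMulMatrix_eq_repr_mul,
    AdjoinRoot.powerBasisAux'_repr_apply_to_fun]
  have h1 : AdjoinRoot.powerBasisAux' hP i = AdjoinRoot.mk P (X ^ (i : ℕ)) := by
    have := (AdjoinRoot.powerBasis' hP).basis_eq_pow i
    rw [map_pow, AdjoinRoot.mk_X]
    exact this
  rw [h1, ← map_mul, AdjoinRoot.modByMonicHom_mk]

/-- Division by a monic polynomial commutes with coefficient maps, hence so does the trace written
through remainders. -/
theorem AdjoinRoot.map_trace_mk {A B : Type*} [CommRing A] [CommRing B] [Nontrivial B]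
    (φ : A →+* B) {P : A[X]} (hP : P.Monic) (f : A[X]) :
    φ (Algebra.trace A (AdjoinRoot P) (AdjoinRoot.mk P f)) =
      Algebra.trace B (AdjoinRoot (P.map φ)) (AdjoinRoot.mk (P.map φ) (f.map φ)) := by
  rw [trace_mk_eq_sum_coeff hP, trace_mk_eq_sum_coeff (hP.map φ), hP.natDegree_map, map_sum]
  refine Finset.sum_congr rfl fun i _ => ?_
  rw [← coeff_map, map_modByMonic φ hP, Polynomial.map_mul, Polynomial.map_pow, map_X]

theorem det_hermiteBlock_map {A B : Type*} [CommRing A] [CommRing B] [Nontrivial B]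
    (φ : A →+* B) {P : A[X]} (hP : P.Monic) (Q : A[X]) (n : ℕ) :
    φ (hermiteBlock P Q n).det = (hermiteBlock (P.map φ) (Q.map φ) n).det := by
  rw [RingHom.map_det]
  congr 1
  ext i j
  simp only [hermiteBlock, RingHom.mapMatrix_apply, Matrix.map_apply, Matrix.of_apply]
  rw [AdjoinRoot.map_trace_mk φ hP, Polynomial.map_mul, Polynomial.map_pow, map_X]

variable {C : Type*} [Field C] [IsAlgClosed C]

/-- Both sides are multiplicative in `g`. For `g = X - r` the identity is the value of the
characteristic polynomial at `r`, up to the sign that both sides share. -/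
theorem Matrix.det_aeval_eq_prod_roots {n : Type*} [Fintype n] [DecidableEq n] (M : Matrix n n C)
    (g : C[X]) : (aeval M g).det = (M.charpoly.roots.map fun z => g.eval z).prod := by
  have hcard : Multiset.card M.charpoly.roots = Fintype.card n := by
    rw [IsAlgClosed.card_roots_eq_natDegree, M.charpoly_natDegree_eq_dim]
  have hC : ∀ c : C, (aeval M (Polynomial.C c)).det =
      (M.charpoly.roots.map fun z => (Polynomial.C c).eval z).prod := by
    intro c
    simp [Matrix.algebraMap_eq_diagonal, hcard]
  have hX : ∀ r : C, (aeval M (X - Polynomial.C r)).det =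
      (M.charpoly.roots.map fun z => (X - Polynomial.C r).eval z).prod := by
    intro r
    have h1 : aeval M (X - Polynomial.C r) = -(Matrix.scalar n r - M) := by
      simp [Matrix.algebraMap_eq_diagonal, Matrix.scalar, Pi.algebraMap_def]
    have h2 : M.charpoly.eval r = (M.charpoly.roots.map fun z => r - z).prod := by
      conv_lhs => rw [(IsAlgClosed.splits M.charpoly).eq_prod_roots_of_monic M.charpoly_monic]
      rw [eval_multiset_prod, Multiset.map_map]
      simp
    rw [h1, Matrix.det_neg, ← Matrix.eval_charpoly, h2, ← hcard]
    rw [← Multiset.card_map (fun z => r - z), ← Multiset.prod_map_neg, Multiset.map_map]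
    simp
  have hmul : ∀ g h : C[X], (aeval M g).det = (M.charpoly.roots.map fun z => g.eval z).prod →
      (aeval M h).det = (M.charpoly.roots.map fun z => h.eval z).prod →
      (aeval M (g * h)).det = (M.charpoly.roots.map fun z => (g * h).eval z).prod := by
    intro g h hg hh
    simp only [map_mul, Matrix.det_mul, hg, hh, eval_mul, Multiset.prod_map_mul]
  rw [(IsAlgClosed.splits g).eq_prod_roots]
  refine hmul _ _ (hC _) ?_
  induction g.roots using Multiset.induction_on with
  | empty => simp
  | cons r s ih =>
    rw [Multiset.map_cons, Multiset.prod_cons]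
    exact hmul _ _ (hX r) ih

/-- The determinant formula applied to `t - g` shows that the eigenvalues of `g(M)` are the `g(z)`,
with multiplicity. -/
theorem Matrix.trace_aeval_eq_sum_roots {n : Type*} [Fintype n] [DecidableEq n] (M : Matrix n n C)
    (g : C[X]) : (aeval M g).trace = (M.charpoly.roots.map fun z => g.eval z).sum := by
  have h1 : (aeval M g).charpoly =
      ((M.charpoly.roots.map fun z => g.eval z).map fun a => X - Polynomial.C a).prod := by
    refine Polynomial.funext fun t => ?_
    have h2 : Matrix.scalar n t - aeval M g = aeval M (Polynomial.C t - g) := by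
      rw [map_sub, aeval_C]; rfl
    rw [Matrix.eval_charpoly, h2, Matrix.det_aeval_eq_prod_roots, eval_multiset_prod,
      Multiset.map_map, Multiset.map_map]
    simp
  rw [Matrix.trace_eq_sum_roots_charpoly, h1, roots_multiset_prod_X_sub_C]

theorem AdjoinRoot.trace_mk_eq_sum_roots {P : C[X]} (hP : P.Monic) (f : C[X]) :
    Algebra.trace C (AdjoinRoot P) (AdjoinRoot.mk P f) = (P.roots.map fun z => f.eval z).sum := by
  let pb := AdjoinRoot.powerBasis hP.ne_zero
  have h1 : AdjoinRoot.mk P f = aeval pb.gen f := by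
    rw [AdjoinRoot.powerBasis_gen, AdjoinRoot.aeval_eq]
  rw [Algebra.trace_eq_matrix_trace pb.basis, h1, ← aeval_algHom_apply,
    Matrix.trace_aeval_eq_sum_roots, charpoly_leftMulMatrix, AdjoinRoot.minpoly_powerBasis_gen_of_monic hP]

end TraceFormula

/-! ### The trace form and its radical -/

section Hermite

/-- The linear form sending `f` to the trace of multiplication by `A * f` on `R[X] / (P)`. -/
noncomputable def traceForm {R : Type*} [CommRing R] (P A : R[X]) : R[X] →ₗ[R] R :=
  Algebra.trace R (AdjoinRoot P) ∘ₗ (AdjoinRoot.mkₐ P).toLinearMap ∘ₗ LinearMap.mulLeft R A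

theorem traceForm_apply {R : Type*} [CommRing R] (P A f : R[X]) :
    traceForm P A f = Algebra.trace R (AdjoinRoot P) (AdjoinRoot.mk P (A * f)) := rfl

theorem traceForm_self_mul {R : Type*} [CommRing R] (P A f : R[X]) :
    traceForm P A (P * f) = 0 := by
  rw [traceForm_apply, mul_left_comm, map_mul (AdjoinRoot.mk P), AdjoinRoot.mk_self, zero_mul,
    map_zero]

theorem traceForm_mul_eq_zero {R : Type*} [CommRing R] {P A q : R[X]} (hP : P.Monic)
    (hq : ∀ j < P.natDegree, traceForm P A (q * X ^ j) = 0) (f : R[X]) :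
    traceForm P A (q * f) = 0 := by
  nontriviality R
  rcases Nat.eq_zero_or_pos P.natDegree with h0 | h0
  · have h1 : q * f = P * (q * f) := by rw [eq_one_of_monic_natDegree_zero hP h0, one_mul]
    rw [h1, traceForm_self_mul]
  · have h1 : q * f = q * (f %ₘ P) + P * (q * (f /ₘ P)) := by
      conv_lhs => rw [← modByMonic_add_div f P]
      ring
    rw [h1, map_add, traceForm_self_mul, add_zero]
    refine LinearMap.map_mul_eq_zero_of_natDegree_lt hq (natDegree_modByMonic_lt f hP ?_)
    rintro rfl
    simp at h0

variable {R : Type*} [Field R] [LinearOrder R] [IsStrictOrderedRing R]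

theorem Complexification.aeval_star (f : R[X]) (z : Complexification R) :
    aeval (star z) f = star (aeval z f) := by
  have h1 := Polynomial.hom_eval₂ f (algebraMap R (Complexification R))
    (starRingEnd (Complexification R)) z
  have h2 : (starRingEnd (Complexification R)).comp (algebraMap R (Complexification R)) =
      algebraMap R (Complexification R) := by
    ext x <;> simp [starRingEnd_apply, QuadraticAlgebra.algebraMap_eq]
  rw [h2] at h1
  simpa [aeval_def, starRingEnd_apply] using h1.symm

theorem Complexification.rootMultiplicity_star (f : R[X]) (z : Complexification R) :
    (f.map (algebraMap R (Complexification R))).rootMultiplicity (star z) =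
      (f.map (algebraMap R (Complexification R))).rootMultiplicity z := by
  have h2 : (starRingEnd (Complexification R)).comp (algebraMap R (Complexification R)) =
      algebraMap R (Complexification R) := by
    ext x <;> simp [starRingEnd_apply, QuadraticAlgebra.algebraMap_eq]
  have h1 := eq_rootMultiplicity_map (p := f.map (algebraMap R (Complexification R)))
    (f := starRingEnd (Complexification R)) (starRingEnd (Complexification R)).injective z
  rw [Polynomial.map_map, h2, starRingEnd_apply] at h1
  exact h1.symm

variable [IsRealClosed R]

theorem algebraMap_traceForm {P : R[X]} (hP : P.Monic) (A f : R[X]) :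
    algebraMap R (Complexification R) (traceForm P A f) =
      ∑ z ∈ (P.aroots (Complexification R)).toFinset,
        (P.map (algebraMap R (Complexification R))).rootMultiplicity z *
          (aeval z A * aeval z f) := by
  rw [traceForm_apply, AdjoinRoot.map_trace_mk (algebraMap R (Complexification R)) hP,
    AdjoinRoot.trace_mk_eq_sum_roots (hP.map _), Finset.sum_multiset_map_count]
  refine Finset.sum_congr rfl fun z _ => ?_
  rw [count_roots, nsmul_eq_mul, Polynomial.map_mul, eval_mul, eval_map_algebraMap,
    eval_map_algebraMap]

/-- The weighted sum of evaluations at the roots, with weights `m(w) A(w) q(w)`, vanishes on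
monomials, hence on all complex polynomials. Testing it on the product of `X - w` over the other
roots isolates the weight at `z`. -/
theorem aeval_eq_zero_of_traceForm_mul_eq_zero {P A q : R[X]} (hP : P.Monic)
    (hq : ∀ f, traceForm P A (q * f) = 0) {z : Complexification R}
    (hz : z ∈ (P.aroots (Complexification R)).toFinset) (hA : aeval z A ≠ 0) :
    aeval z q = 0 := by
  classical
  set Z := (P.aroots (Complexification R)).toFinset with hZ
  set m := fun z : Complexification R =>
    (P.map (algebraMap R (Complexification R))).rootMultiplicity z with hm
  let Λ : (Complexification R)[X] →ₗ[Complexification R] Complexification R :=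
    ∑ w ∈ Z, ((m w : Complexification R) * (aeval w A * aeval w q)) • Polynomial.leval w
  have hΛ : ∀ h, Λ h = ∑ w ∈ Z, ((m w : Complexification R) * (aeval w A * aeval w q)) *
      h.eval w := by
    intro h
    simp [Λ, LinearMap.sum_apply, leval_apply]
  have hΛ0 : Λ = 0 := by
    refine Polynomial.lhom_ext' fun k => LinearMap.ext_ring ?_
    have h1 := algebraMap_traceForm hP A (q * X ^ k)
    rw [hq, map_zero] at h1
    simp only [LinearMap.comp_apply, LinearMap.zero_apply, hΛ, eval_monomial, one_mul]
    rw [h1]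
    refine Finset.sum_congr rfl fun w _ => ?_
    rw [map_mul, map_pow, aeval_X]
    ring
  have h1 := hΛ (∏ w ∈ Z.erase z, (X - C w))
  rw [hΛ0, LinearMap.zero_apply, Finset.sum_eq_single_of_mem z hz] at h1
  · have hm0 : (m z : Complexification R) ≠ 0 := by
      have : 0 < m z := by
        rw [hm]
        have := hz
        rw [hZ, Multiset.mem_toFinset, ← Multiset.count_pos, count_roots] at this
        exact this
      exact_mod_cast this.ne'
    have hprod : (∏ w ∈ Z.erase z, (X - C w)).eval z ≠ 0 := by
      rw [eval_prod, Finset.prod_ne_zero_iff]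
      intro w hw
      rw [eval_sub, eval_X, eval_C, sub_ne_zero]
      exact (Finset.ne_of_mem_erase hw).symm
    have h2 := (mul_eq_zero.1 h1.symm).resolve_right hprod
    exact (mul_eq_zero.1 ((mul_eq_zero.1 h2).resolve_left hm0)).resolve_left hA
  · intro w hw hwz
    rw [eval_prod, Finset.prod_eq_zero (Finset.mem_erase.2 ⟨hwz, hw⟩) (by simp), mul_zero]

end Hermite

/-! ### Hermite's theorem and Tarski queries -/

section Tarski

theorem sum_sign_eq_card_sub_card {R ι : Type*} [Zero R] [LinearOrder R] (Z : Finset ι) (w : ι → R) :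
    ∑ x ∈ Z, ((SignType.sign (w x) : SignType) : ℤ) =
      ((Z.filter fun x => 0 < w x).card : ℤ) - (Z.filter fun x => w x < 0).card := by
  rw [Finset.card_filter, Finset.card_filter, Nat.cast_sum, Nat.cast_sum, ← Finset.sum_sub_distrib]
  refine Finset.sum_congr rfl fun x _ => ?_
  rcases lt_trichotomy (w x) 0 with h | h | h
  · simp [h, h.not_gt]
  · simp [h]
  · simp [h, h.not_gt]

variable {R : Type*} [Field R] [LinearOrder R] [IsStrictOrderedRing R]

theorem Complexification.im_aeval_eq_zero (f : R[X]) {z : Complexification R} (hz : z.im = 0) :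
    (aeval z f).im = 0 := by
  have h1 : star z = z := by ext <;> simp [hz]
  have h2 := congrArg QuadraticAlgebra.im (Complexification.aeval_star f z)
  rw [h1, QuadraticAlgebra.im_star] at h2
  linarith

theorem Complexification.star_mem_aroots {P : R[X]} {z : Complexification R}
    (hz : z ∈ (P.aroots (Complexification R)).toFinset) :
    star z ∈ (P.aroots (Complexification R)).toFinset := by
  rw [Multiset.mem_toFinset, mem_aroots] at hz ⊢
  exact ⟨hz.1, by rw [Complexification.aeval_star, hz.2, star_zero]⟩

theorem Complexification.filter_filter_im_pos {R : Type*} [Field R] [LinearOrder R]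
    (Z : Finset (Complexification R)) :
    ((Z.filter fun z => ¬ z.im = 0).filter fun z => 0 < z.im) = Z.filter fun z => 0 < z.im := by
  rw [Finset.filter_filter]
  exact Finset.filter_congr fun z _ => ⟨fun h => h.2, fun h => ⟨h.ne', h⟩⟩

theorem Complexification.filter_filter_im_not_pos {R : Type*} [Field R] [LinearOrder R]
    (Z : Finset (Complexification R)) :
    ((Z.filter fun z => ¬ z.im = 0).filter fun z => ¬ 0 < z.im) =
      Z.filter fun z => z.im < 0 := by
  rw [Finset.filter_filter]
  exact Finset.filter_congr fun z _ =>
    ⟨fun h => lt_of_le_of_ne (not_lt.1 h.2) h.1, fun h => ⟨h.ne, h.not_gt⟩⟩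

theorem Complexification.card_filter_eq {Z : Finset (Complexification R)}
    (hZ : ∀ z ∈ Z, star z ∈ Z) :
    Z.card = (Z.filter fun z => z.im = 0).card + 2 * (Z.filter fun z => 0 < z.im).card := by
  have h1 : (Z.filter fun z => z.im < 0).card = (Z.filter fun z => 0 < z.im).card := by
    refine Finset.card_bij' (fun z _ => star z) (fun z _ => star z) ?_ ?_ ?_ ?_ <;>
      intro z hz <;> rw [Finset.mem_filter] at hz <;> simp [hz.2, hZ z hz.1]
  have h2 := Finset.card_filter_add_card_filter_not (s := Z) fun z => z.im = 0
  have h3 := Finset.card_filter_add_card_filter_not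
    (s := Z.filter fun z => ¬ z.im = 0) fun z => 0 < z.im
  rw [filter_filter_im_pos, filter_filter_im_not_pos] at h3
  omega

theorem card_filter_aroots_real {P : R[X]} (hP : P.Monic) (A : R[X]) (p : R → Prop)
    [DecidablePred p] :
    ((P.aroots (Complexification R)).toFinset.filter
      fun z => z.im = 0 ∧ p (aeval z A).re).card =
      (P.roots.toFinset.filter fun x => p (A.eval x)).card := by
  symm
  refine Finset.card_bij' (fun x _ => algebraMap R (Complexification R) x) (fun z _ => z.re)
    ?_ ?_ ?_ ?_
  · intro x hx
    simp only [Finset.mem_filter, Multiset.mem_toFinset, mem_roots hP.ne_zero, mem_aroots] at hx ⊢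
    refine ⟨⟨hP.ne_zero, ?_⟩, by simp, ?_⟩
    · rw [aeval_algebraMap_apply, coe_aeval_eq_eval, hx.1.eq_zero, map_zero]
    · rw [aeval_algebraMap_apply, coe_aeval_eq_eval]; exact hx.2
  · intro z hz
    simp only [Finset.mem_filter, Multiset.mem_toFinset, mem_roots hP.ne_zero, mem_aroots] at hz ⊢
    have hz1 : z = algebraMap R (Complexification R) z.re := by ext <;> simp [hz.2.1]
    have h1 := hz.1.2
    have h2 := hz.2.2
    rw [hz1, aeval_algebraMap_apply, coe_aeval_eq_eval] at h1 h2
    exact ⟨(map_eq_zero _).1 h1, h2⟩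
  · intro x _; simp
  · intro z hz
    rw [Finset.mem_filter] at hz
    ext <;> simp [hz.2.1]

variable [IsRealClosed R]

/-- With `v z` a square root of the weight at `z`, each root contributes the real part of `(v z *
f(z))²`, a difference of two squares. Conjugate roots contribute equally, so only the upper half
plane remains, with a factor 2. -/
theorem traceForm_mul_self_eq {P : R[X]} (hP : P.Monic) (A : R[X])
    {v : Complexification R → Complexification R}
    (hv : ∀ z, ((P.map (algebraMap R (Complexification R))).rootMultiplicity z :
      Complexification R) * aeval z A = v z * v z) (f : R[X]) :
    traceForm P A (f * f) =
      ∑ z ∈ (P.aroots (Complexification R)).toFinset with z.im = 0,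
        ((P.map (algebraMap R (Complexification R))).rootMultiplicity z : R) *
          (aeval z A).re * (aeval z f).re ^ 2 +
      ∑ z ∈ (P.aroots (Complexification R)).toFinset with 0 < z.im,
        2 * ((v z * aeval z f).re ^ 2 - (v z * aeval z f).im ^ 2) := by
  set Z := (P.aroots (Complexification R)).toFinset with hZ
  have h1 := congrArg QuadraticAlgebra.re (algebraMap_traceForm hP A (f * f))
  rw [QuadraticAlgebra.algebraMap_re, ← QuadraticAlgebra.reₗ_apply, map_sum] at h1
  have hterm : ∀ z, (((P.map (algebraMap R (Complexification R))).rootMultiplicity z :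
      Complexification R) * (aeval z A * aeval z (f * f))).re =
      (v z * aeval z f).re ^ 2 - (v z * aeval z f).im ^ 2 := by
    intro z
    have h2 : ((P.map (algebraMap R (Complexification R))).rootMultiplicity z :
      Complexification R) * (aeval z A * aeval z (f * f)) =
        (v z * aeval z f) * (v z * aeval z f) := by
      rw [← mul_assoc, hv, map_mul]; ring
    rw [h2]; simp; ring
  have hstar : ∀ z, ((v (star z) * aeval (star z) f).re ^ 2 -
      (v (star z) * aeval (star z) f).im ^ 2) =
      (v z * aeval z f).re ^ 2 - (v z * aeval z f).im ^ 2 := by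
    intro z
    rw [← hterm, ← hterm, Complexification.rootMultiplicity_star, Complexification.aeval_star,
      Complexification.aeval_star]
    simp only [QuadraticAlgebra.re_mul, QuadraticAlgebra.im_mul, QuadraticAlgebra.re_star,
      QuadraticAlgebra.im_star, QuadraticAlgebra.re_natCast, QuadraticAlgebra.im_natCast]
    ring
  have hneg : ∑ z ∈ Z with z.im < 0,
      ((v z * aeval z f).re ^ 2 - (v z * aeval z f).im ^ 2) =
      ∑ z ∈ Z with 0 < z.im, ((v z * aeval z f).re ^ 2 - (v z * aeval z f).im ^ 2) := by
    refine Finset.sum_bij' (fun z _ => star z) (fun z _ => star z) ?_ ?_ ?_ ?_ ?_ <;>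
      intro z hz <;> rw [Finset.mem_filter] at hz
    · simp [hz.2, Complexification.star_mem_aroots hz.1, hZ]
    · simp [hz.2, Complexification.star_mem_aroots hz.1, hZ]
    · simp
    · simp
    · exact (hstar z).symm
  rw [h1, ← Finset.sum_filter_add_sum_filter_not Z fun z => z.im = 0]
  congr 1
  · refine Finset.sum_congr rfl fun z hz => ?_
    have hz0 := (Finset.mem_filter.1 hz).2
    rw [QuadraticAlgebra.reₗ_apply]
    simp [Complexification.im_aeval_eq_zero _ hz0]
    ring
  · rw [← Finset.sum_filter_add_sum_filter_not (Z.filter fun z => ¬ z.im = 0) fun z => 0 < z.im,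
      Complexification.filter_filter_im_pos, Complexification.filter_filter_im_not_pos]
    simp only [QuadraticAlgebra.reₗ_apply, hterm]
    rw [hneg, ← two_mul, Finset.mul_sum]

/-- Hermite's theorem, with the signature of the Hermite form read off from diagonal families. -/
theorem sum_sign_roots_eq_of_diagonal {P : R[X]} (hP : P.Monic) (A : R[X]) {r : ℕ}
    (hr : hankelDet (traceForm P A) r ≠ 0)
    (hz : ∀ m, r < m → m ≤ P.natDegree → hankelDet (traceForm P A) m = 0)
    {S T : Finset ℕ} (hS : S ⊆ Finset.range r) (hT : T ⊆ Finset.range r)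
    (hcard : S.card + T.card = r) {u : ℕ → R[X]} (hum : ∀ s < r, (u s).Monic)
    (hud : ∀ s < r, (u s).natDegree = s)
    (hSo : ∀ s ∈ S, ∀ t ∈ S, s ≠ t → traceForm P A (u s * u t) = 0)
    (hSp : ∀ s ∈ S, 0 ≤ traceForm P A (u s * u s))
    (hTo : ∀ s ∈ T, ∀ t ∈ T, s ≠ t → traceForm P A (u s * u t) = 0)
    (hTp : ∀ s ∈ T, traceForm P A (u s * u s) ≤ 0) :
    ∑ x ∈ P.roots.toFinset, ((SignType.sign (A.eval x) : SignType) : ℤ) =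
      (S.card : ℤ) - T.card := by
  choose v hv using fun z : Complexification R => IsAlgClosed.exists_eq_mul_self
    (((P.map (algebraMap R (Complexification R))).rootMultiplicity z :
      Complexification R) * aeval z A)
  set Z := (P.aroots (Complexification R)).toFinset with hZ
  set m := fun z : Complexification R =>
    (P.map (algebraMap R (Complexification R))).rootMultiplicity z with hm
  have hmpos : ∀ z ∈ Z, (0 : R) < (m z : R) := by
    intro z hz
    rw [hZ, Multiset.mem_toFinset, ← Multiset.count_pos, count_roots] at hz
    exact_mod_cast hz
  -- Roots in `Zp` give a positive square, those in `Zn` a negative one, and each conjugate pair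
  -- represented in `Zi` gives one of each.
  let Zp := Z.filter fun z => z.im = 0 ∧ 0 < (aeval z A).re
  let Zn := Z.filter fun z => z.im = 0 ∧ (aeval z A).re < 0
  let Zi := Z.filter fun z => 0 < z.im ∧ aeval z A ≠ 0
  let ev : Complexification R → R[X] →ₗ[R] Complexification R := fun z => (aeval z).toLinearMap
  let reL : Complexification R → R[X] →ₗ[R] R := fun z => QuadraticAlgebra.reₗ (-1) 0 ∘ₗ ev z
  let reM : Complexification R → R[X] →ₗ[R] R := fun z =>
    QuadraticAlgebra.reₗ (-1) 0 ∘ₗ LinearMap.mulLeft R (v z) ∘ₗ ev z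
  let imM : Complexification R → R[X] →ₗ[R] R := fun z =>
    QuadraticAlgebra.imₗ (-1) 0 ∘ₗ LinearMap.mulLeft R (v z) ∘ₗ ev z
  let φ : Zp ⊕ Zi → R[X] →ₗ[R] R := Sum.elim (fun z => reL z) fun z => reM z
  let ψ : Zn ⊕ Zi → R[X] →ₗ[R] R := Sum.elim (fun z => reL z) fun z => imM z
  let c : Zp ⊕ Zi → R := Sum.elim (fun z => m z * (aeval (z : Complexification R) A).re)
    fun _ => 2
  let d : Zn ⊕ Zi → R := Sum.elim (fun z => m z * -(aeval (z : Complexification R) A).re)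
    fun _ => 2
  have hc : ∀ i, 0 < c i := by
    rintro (⟨z, hz⟩ | z)
    · have := Finset.mem_filter.1 hz
      exact mul_pos (hmpos z this.1) this.2.2
    · exact two_pos
  have hd : ∀ i, 0 < d i := by
    rintro (⟨z, hz⟩ | z)
    · have := Finset.mem_filter.1 hz
      exact mul_pos (hmpos z this.1) (neg_pos.2 this.2.2)
    · exact two_pos
  have hL : ∀ f, traceForm P A (f * f) = ∑ i, c i * φ i f ^ 2 - ∑ j, d j * ψ j f ^ 2 := by
    intro f
    have e1 : ∑ i, c i * φ i f ^ 2 =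
        ∑ z ∈ Zp, (m z : R) * (aeval z A).re * (aeval z f).re ^ 2 +
          ∑ z ∈ Zi, 2 * (v z * aeval z f).re ^ 2 := by
      rw [Fintype.sum_sum_type, ← Finset.sum_coe_sort Zp, ← Finset.sum_coe_sort Zi]
      rfl
    have e2 : ∑ i, d i * ψ i f ^ 2 =
        ∑ z ∈ Zn, (m z : R) * -(aeval z A).re * (aeval z f).re ^ 2 +
          ∑ z ∈ Zi, 2 * (v z * aeval z f).im ^ 2 := by
      rw [Fintype.sum_sum_type, ← Finset.sum_coe_sort Zn, ← Finset.sum_coe_sort Zi]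
      rfl
    have e3 : ∑ z ∈ Z with z.im = 0, (m z : R) * (aeval z A).re * (aeval z f).re ^ 2 =
        ∑ z ∈ Zp, (m z : R) * (aeval z A).re * (aeval z f).re ^ 2 -
          ∑ z ∈ Zn, (m z : R) * -(aeval z A).re * (aeval z f).re ^ 2 := by
      simp only [Zp, Zn, Finset.sum_filter]
      rw [← Finset.sum_sub_distrib]
      refine Finset.sum_congr rfl fun z _ => ?_
      by_cases h0 : z.im = 0
      · rcases lt_trichotomy (aeval z A).re 0 with h | h | h
        · simp [h0, h, h.not_gt]
        · simp [h0, h]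
        · simp [h0, h, h.not_gt]
      · simp [h0]
    have e4 : ∑ z ∈ Z with 0 < z.im, 2 * ((v z * aeval z f).re ^ 2 - (v z * aeval z f).im ^ 2) =
        ∑ z ∈ Zi, 2 * (v z * aeval z f).re ^ 2 - ∑ z ∈ Zi, 2 * (v z * aeval z f).im ^ 2 := by
      simp only [Zi, Finset.sum_filter]
      rw [← Finset.sum_sub_distrib]
      refine Finset.sum_congr rfl fun z _ => ?_
      by_cases h0 : aeval z A = 0
      · have hv0 : v z = 0 := mul_self_eq_zero.1 (by rw [← hv, h0, mul_zero])
        simp [hv0]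
      · by_cases h1 : 0 < z.im
        · simp [h0, h1, mul_sub]
        · simp [h1]
    rw [traceForm_mul_self_eq hP A hv f, e1, e2]
    rw [hm] at e3
    rw [e3, e4]
    ring
  have hSI := card_le_card_of_forall_map_mul_self_eq hd hL hr hS hum hud hSo hSp
  have hTJ := card_le_card_of_forall_map_mul_self_eq (L := -traceForm P A) (φ := ψ) (ψ := φ) hc
    (fun f => by rw [LinearMap.neg_apply, hL f, neg_sub])
    (by rw [hankelDet_neg]; exact mul_ne_zero (pow_ne_zero _ (by norm_num)) hr) hT hum hud
    (fun s hs t ht hst => by rw [LinearMap.neg_apply, hTo s hs t ht hst, neg_zero])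
    (fun s hs => by rw [LinearMap.neg_apply]; exact neg_nonneg.2 (hTp s hs))
  simp only [Fintype.card_sum, Fintype.card_coe] at hSI hTJ
  -- The monic orthogonal polynomial of degree `r` lies in the radical, so it vanishes at every root
  -- where `A` does not; this bounds their number. As `S.card + T.card = r`, the inequalities
  -- `S.card ≤ Zp.card + Zi.card` and `T.card ≤ Zn.card + Zi.card` become equalities, and the pairs
  -- cancel in the difference.
  have hbound : Zp.card + Zn.card + 2 * Zi.card ≤ r := by
    obtain ⟨q, hq, hqn, hq0⟩ := exists_monic_orthogonal hr
    have hq1 : ∀ j < P.natDegree, traceForm P A (q * X ^ j) = 0 := by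
      intro j hj
      rcases le_total P.natDegree r with h | h
      · exact hq0 j (by omega)
      · obtain ⟨e, he⟩ := Nat.exists_eq_add_of_le h
        exact map_mul_X_pow_eq_zero_of_hankelDet hr hq hqn hq0 e
          (fun k hk hk' => hz k hk (by omega)) j (by omega)
    have hq2 := traceForm_mul_eq_zero hP hq1
    let W := Z.filter fun z => aeval z A ≠ 0
    have hWq : W ⊆ (q.aroots (Complexification R)).toFinset := by
      intro z hz
      have hz := Finset.mem_filter.1 hz
      rw [Multiset.mem_toFinset, mem_aroots]
      exact ⟨hq.ne_zero, aeval_eq_zero_of_traceForm_mul_eq_zero hP hq2 hz.1 hz.2⟩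
    have hWr : W.card ≤ r := by
      refine (Finset.card_le_card hWq).trans ((Multiset.toFinset_card_le _).trans ?_)
      refine (card_roots' _).trans ?_
      rw [natDegree_map, hqn]
    have hWs : ∀ z ∈ W, star z ∈ W := by
      intro z hz
      have hz := Finset.mem_filter.1 hz
      refine Finset.mem_filter.2 ⟨Complexification.star_mem_aroots hz.1, ?_⟩
      rw [Complexification.aeval_star]
      simpa using hz.2
    have hWc := Complexification.card_filter_eq hWs
    have hWi : W.filter (fun z => 0 < z.im) = Zi := by
      simp only [W, Zi, Finset.filter_filter]
      exact Finset.filter_congr fun z _ => and_comm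
    have hWre : W.filter (fun z => z.im = 0) = Zp ∪ Zn := by
      ext z
      simp only [W, Zp, Zn, Finset.mem_filter, Finset.mem_union]
      by_cases h0 : z.im = 0
      · have h1 : aeval z A ≠ 0 ↔ (aeval z A).re ≠ 0 := by
          rw [not_iff_not]
          exact ⟨fun h => by rw [h]; rfl, fun h => by
            ext
            · exact h
            · exact Complexification.im_aeval_eq_zero A h0⟩
        simp only [h1, h0, ne_iff_lt_or_gt]
        tauto
      · simp [h0]
    have hdisj : Disjoint Zp Zn := by
      rw [Finset.disjoint_left]
      intro z hz hz'
      exact lt_asymm (Finset.mem_filter.1 hz).2.2 (Finset.mem_filter.1 hz').2.2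
    rw [hWi, hWre, Finset.card_union_of_disjoint hdisj] at hWc
    omega
  have hp := card_filter_aroots_real hP A fun x => 0 < x
  have hn := card_filter_aroots_real hP A fun x => x < 0
  rw [sum_sign_eq_card_sub_card, ← hp, ← hn]
  change (Zp.card : ℤ) - Zn.card = _
  omega

/-- The signs of the leading principal minors of the Hermite matrix determine the Tarski query. -/
theorem sum_sign_roots_eq_of_sign_hermite_eq {P₁ P₂ A₁ A₂ : R[X]} (hP₁ : P₁.Monic)
    (hP₂ : P₂.Monic) (hdeg : P₁.natDegree = P₂.natDegree)
    (h : ∀ n, 1 ≤ n → n ≤ P₁.natDegree → SignType.sign (hermiteBlock P₁ A₁ n).det =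
      SignType.sign (hermiteBlock P₂ A₂ n).det) :
    ∑ x ∈ P₁.roots.toFinset, ((SignType.sign (A₁.eval x) : SignType) : ℤ) =
      ∑ x ∈ P₂.roots.toFinset, ((SignType.sign (A₂.eval x) : SignType) : ℤ) := by
  set σ : ℕ → SignType := fun m => SignType.sign (hankelDet (traceForm P₁ A₁) m) with hσ
  have hσ0 : σ 0 ≠ 0 := by simp [hσ, hankelDet_zero]
  have h2 : ∀ m ≤ P₁.natDegree, SignType.sign (hankelDet (traceForm P₂ A₂) m) = σ m := by
    intro m hm
    rcases Nat.eq_zero_or_pos m with rfl | hpos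
    · simp [hσ, hankelDet_zero]
    · exact (h m hpos hm).symm
  obtain ⟨r, hr⟩ : ∃ r, r = Nat.findGreatest (fun m => σ m ≠ 0) P₁.natDegree := ⟨_, rfl⟩
  have hrle : r ≤ P₁.natDegree := hr ▸ Nat.findGreatest_le _
  have hσr : σ r ≠ 0 :=
    hr ▸ Nat.findGreatest_spec (P := fun m => σ m ≠ 0) (Nat.zero_le P₁.natDegree) hσ0
  have hzero : ∀ m, r < m → m ≤ P₁.natDegree → σ m = 0 := fun m hm hm' =>
    not_not.1 (Nat.findGreatest_is_greatest (hr ▸ hm) hm')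
  -- The index sets depend on the signs alone, so the same `S` and `T` serve both trace forms.
  obtain ⟨S, T, hS, hT, hcard, hST⟩ := exists_index_sets (R := R) σ hσ0 r hσr
  obtain ⟨u, hum, hud, hSo, hSp, hTo, hTp⟩ := hST (traceForm P₁ A₁) fun m _ => rfl
  obtain ⟨u', hum', hud', hSo', hSp', hTo', hTp'⟩ :=
    hST (traceForm P₂ A₂) fun m hm => h2 m (hm.trans hrle)
  rw [sum_sign_roots_eq_of_diagonal hP₁ A₁ (sign_ne_zero.1 hσr)
      (fun m hm hm' => sign_eq_zero_iff.1 (hzero m hm hm')) hS hT hcard hum hud hSo hSp hTo hTp,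
    sum_sign_roots_eq_of_diagonal hP₂ A₂ (sign_ne_zero.1 ((h2 r hrle).trans_ne hσr))
      (fun m hm hm' => sign_eq_zero_iff.1 ((h2 m (by omega)).trans (hzero m hm (by omega))))
      hS hT hcard hum' hud' hSo' hSp' hTo' hTp']

end Tarski

/-! ### Sparse functions on sign vectors and their moments -/

section Moments

theorem SignType.sum_univ {M : Type*} [AddCommMonoid M] (f : SignType → M) :
    ∑ a, f a = f 0 + f (-1) + f 1 := by
  have h : (Finset.univ : Finset SignType) = {0, -1, 1} := by decide
  rw [h, Finset.sum_insert (by decide), Finset.sum_pair (by decide), add_assoc]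

theorem Fin.sum_univ_cons {s : ℕ} {M : Type*} [AddCommMonoid M]
    (f : (Fin (s + 1) → SignType) → M) :
    ∑ σ, f σ = ∑ ξ : Fin s → SignType, ∑ a : SignType, f (Fin.cons a ξ) := by
  rw [← (Fin.consEquiv fun _ : Fin (s + 1) => SignType).sum_comp, Fintype.sum_prod_type_right]
  rfl

/-- A function on sign vectors with at most `m` nonzero values vanishes as soon as its moments with
at most `log₂ m` nonzero exponents vanish. -/
theorem eq_zero_of_forall_sum_mul_prod_pow_eq_zero (s : ℕ) :
    ∀ (g : (Fin s → SignType) → ℤ) (m : ℕ), (Finset.univ.filter fun σ => g σ ≠ 0).card ≤ m →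
      (∀ α : Fin s → ℕ, (∀ i, α i ≤ 2) → 2 ^ (Finset.univ.filter fun i => α i ≠ 0).card ≤ m →
        ∑ σ, g σ * ∏ i, (σ i : ℤ) ^ α i = 0) → g = 0 := by
  induction s with
  | zero =>
    intro g m hm h
    funext σ
    by_contra hσ
    have h1 : 0 < (Finset.univ.filter fun σ => g σ ≠ 0).card :=
      Finset.card_pos.2 ⟨σ, Finset.mem_filter.2 ⟨Finset.mem_univ _, hσ⟩⟩
    have h2 := h (fun _ => 0) (by simp) (by simp; omega)
    rw [Fintype.sum_subsingleton _ σ] at h2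
    exact hσ (by simpa using h2)
  | succ s ih =>
    intro g m hm h
    -- `G j` is the `j`-th moment in the first coordinate. Its moments are moments of `g`, so the
    -- induction hypothesis applies to it.
    let G : ℕ → (Fin s → SignType) → ℤ := fun j ξ => ∑ a : SignType, g (Fin.cons a ξ) * (a : ℤ) ^ j
    have hmom : ∀ j (α : Fin s → ℕ), ∑ ξ, G j ξ * ∏ i, (ξ i : ℤ) ^ α i =
        ∑ σ, g σ * ∏ i, (σ i : ℤ) ^ (Fin.cons j α : Fin (s + 1) → ℕ) i := by
      intro j α
      rw [Fin.sum_univ_cons]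
      refine Finset.sum_congr rfl fun ξ _ => ?_
      rw [Finset.sum_mul]
      refine Finset.sum_congr rfl fun a _ => ?_
      rw [Fin.prod_univ_succ]
      simp [mul_assoc]
    have hcons : ∀ j (α : Fin s → ℕ), (Finset.univ.filter fun i =>
        (Fin.cons j α : Fin (s + 1) → ℕ) i ≠ 0).card =
        (if j ≠ 0 then 1 else 0) + (Finset.univ.filter fun i => α i ≠ 0).card := by
      intro j α
      rw [Finset.card_filter, Finset.card_filter, Fin.sum_univ_succ]
      simp
    have hle : ∀ j (α : Fin s → ℕ), j ≤ 2 → (∀ i, α i ≤ 2) →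
        ∀ i, (Fin.cons j α : Fin (s + 1) → ℕ) i ≤ 2 := by
      intro j α hj hα i
      refine Fin.cases ?_ (fun i => ?_) i
      · simpa using hj
      · simpa using hα i
    have hcard : (Finset.univ.filter fun σ => g σ ≠ 0).card =
        ∑ ξ : Fin s → SignType, (Finset.univ.filter fun a => g (Fin.cons a ξ) ≠ 0).card := by
      rw [Finset.card_filter, Fin.sum_univ_cons]
      exact Finset.sum_congr rfl fun ξ _ => (Finset.card_filter _ _).symm
    have hGne : ∀ j ξ, G j ξ ≠ 0 →
        1 ≤ (Finset.univ.filter fun a => g (Fin.cons a ξ) ≠ 0).card := by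
      intro j ξ hne
      by_contra! hlt
      refine hne (Finset.sum_eq_zero fun a _ => ?_)
      have h1 := Finset.card_eq_zero.1 (Nat.lt_one_iff.1 hlt)
      have h2 := Finset.filter_eq_empty_iff.1 h1 (Finset.mem_univ a)
      rw [not_not.1 h2, zero_mul]
    have hG0 : G 0 = 0 := by
      refine ih _ m ?_ fun α hα hαm => ?_
      · refine le_trans ?_ hm
        rw [hcard, Finset.card_filter]
        refine Finset.sum_le_sum fun ξ _ => ?_
        split_ifs with hξ
        · exact hGne 0 ξ hξ
        · exact Nat.zero_le _
      · rw [hmom]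
        exact h _ (hle 0 α (by omega) hα) (by rw [hcons]; simpa using hαm)
    -- As `G 0 = 0`, a fibre cannot contain exactly one nonzero value of `g`.
    have hGne2 : ∀ j ξ, G j ξ ≠ 0 →
        2 ≤ (Finset.univ.filter fun a => g (Fin.cons a ξ) ≠ 0).card := by
      intro j ξ hne
      by_contra! hlt
      have h1 : (Finset.univ.filter fun a => g (Fin.cons a ξ) ≠ 0).card = 1 :=
        le_antisymm (Nat.lt_succ_iff.1 hlt) (hGne j ξ hne)
      obtain ⟨a, ha⟩ := Finset.card_eq_one.1 h1
      have h2 : g (Fin.cons a ξ) ≠ 0 := by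
        have : a ∈ Finset.univ.filter fun a => g (Fin.cons a ξ) ≠ 0 := by rw [ha]; simp
        simpa using this
      have h3 : G 0 ξ = g (Fin.cons a ξ) := by
        refine (Finset.sum_eq_single a (fun b _ hb => ?_) (by simp)).trans (by simp)
        by_contra hb0
        have : b ∈ Finset.univ.filter fun a => g (Fin.cons a ξ) ≠ 0 := by
          simpa using left_ne_zero_of_mul hb0
        rw [ha] at this
        exact hb (by simpa using this)
      rw [hG0] at h3
      exact h2 h3.symm
    have hGj : ∀ j, j ≠ 0 → j ≤ 2 → G j = 0 := by
      intro j hj0 hj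
      -- Every point of the support of `G j` uses up two of `g`; halving the bound pays for the
      -- extra nonzero exponent `j`.
      refine ih _ (m / 2) ?_ fun α hα hαm => ?_
      · rw [Nat.le_div_iff_mul_le two_pos]
        refine le_trans ?_ hm
        rw [hcard, Finset.card_filter, Finset.sum_mul]
        refine Finset.sum_le_sum fun ξ _ => ?_
        split_ifs with hξ
        · simpa using hGne2 j ξ hξ
        · simp
      · rw [hmom]
        refine h _ (hle j α hj hα) ?_
        rw [hcons, if_pos hj0, add_comm, pow_succ]
        exact (Nat.le_div_iff_mul_le two_pos).1 hαm
    -- The moments of orders 0, 1, 2 determine a function on `{-1, 0, 1}` (a Vandermonde system).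
    have key : ∀ ξ a, g (Fin.cons a ξ) = 0 := by
      intro ξ a
      have e0 := congrFun hG0 ξ
      have e1 := congrFun (hGj 1 one_ne_zero (by omega)) ξ
      have e2 := congrFun (hGj 2 two_ne_zero (by omega)) ξ
      simp only [G, SignType.sum_univ, Pi.zero_apply, pow_zero, mul_one, pow_one,
        SignType.coe_zero, SignType.coe_one, SignType.coe_neg_one, mul_zero, zero_add] at e0 e1 e2
      cases a
      · change g (Fin.cons 0 ξ) = 0; linarith
      · change g (Fin.cons (-1) ξ) = 0; linarith
      · change g (Fin.cons 1 ξ) = 0; linarith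
    funext σ
    rw [← Fin.cons_self_tail σ]
    exact key _ _

/-- Weighted families of sign vectors with the same moments have the same weights. -/
theorem sum_filter_eq_of_moments_eq {X : Type*} {s m : ℕ} {Z₁ Z₂ : Finset X}
    {c₁ c₂ : X → Fin s → SignType} {w₁ w₂ : X → ℤ}
    (hm : (Z₁.image c₁ ∪ Z₂.image c₂).card ≤ m)
    (h : ∀ α : Fin s → ℕ, (∀ i, α i ≤ 2) → 2 ^ (Finset.univ.filter fun i => α i ≠ 0).card ≤ m →
      ∑ x ∈ Z₁, w₁ x * ∏ i, (c₁ x i : ℤ) ^ α i = ∑ x ∈ Z₂, w₂ x * ∏ i, (c₂ x i : ℤ) ^ α i)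
    (σ : Fin s → SignType) :
    ∑ x ∈ Z₁ with c₁ x = σ, w₁ x = ∑ x ∈ Z₂ with c₂ x = σ, w₂ x := by
  have hfib : ∀ (Z : Finset X) (c : X → Fin s → SignType) (w : X → ℤ) (α : Fin s → ℕ),
      ∑ σ, (∑ x ∈ Z with c x = σ, w x) * ∏ i, (σ i : ℤ) ^ α i =
        ∑ x ∈ Z, w x * ∏ i, (c x i : ℤ) ^ α i := by
    intro Z c w α
    rw [← Finset.sum_fiberwise Z c]
    refine Finset.sum_congr rfl fun σ _ => ?_
    rw [Finset.sum_mul]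
    refine Finset.sum_congr rfl fun x hx => ?_
    rw [(Finset.mem_filter.1 hx).2]
  have hzero : ∀ (Z : Finset X) (c : X → Fin s → SignType) (w : X → ℤ) (σ : Fin s → SignType),
      σ ∉ Z.image c → ∑ x ∈ Z with c x = σ, w x = 0 := by
    intro Z c w σ hσ
    rw [Finset.filter_eq_empty_iff.2 fun x hx hxσ => hσ (Finset.mem_image.2 ⟨x, hx, hxσ⟩),
      Finset.sum_empty]
  refine sub_eq_zero.1 (congrFun (eq_zero_of_forall_sum_mul_prod_pow_eq_zero s
    (fun σ => ∑ x ∈ Z₁ with c₁ x = σ, w₁ x - ∑ x ∈ Z₂ with c₂ x = σ, w₂ x) m ?_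
    fun α hα hαm => ?_) σ)
  · refine (Finset.card_le_card fun σ hσ => ?_).trans hm
    by_contra hσ'
    rw [Finset.mem_union, not_or] at hσ'
    rw [Finset.mem_filter, hzero _ _ _ _ hσ'.1, hzero _ _ _ _ hσ'.2] at hσ
    simp at hσ
  · simp only [sub_mul, Finset.sum_sub_distrib, hfib, h α hα hαm, sub_self]

end Moments

/-! ### Specializing the parameters and matching the roots -/

section Specialization

variable {K R : Type*} [Field K] [Field R] [Algebra K R] {k : ℕ}

theorem specialize_mul (υ : Fin k → R) (P Q : (MvPolynomial (Fin k) K)[X]) :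
    specialize υ (P * Q) = specialize υ P * specialize υ Q := Polynomial.map_mul _

theorem specialize_prod_pow (υ : Fin k → R) {ι : Type*} (s : Finset ι)
    (f : ι → (MvPolynomial (Fin k) K)[X]) (α : ι → ℕ) :
    specialize υ (∏ i ∈ s, f i ^ α i) = ∏ i ∈ s, specialize υ (f i) ^ α i := by
  simp only [specialize, Polynomial.map_prod, Polynomial.map_pow]

theorem specialize_iterate_derivative (υ : Fin k → R) (P : (MvPolynomial (Fin k) K)[X]) (h : ℕ) :
    specialize υ (derivative^[h] P) = derivative^[h] (specialize υ P) :=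
  (iterate_derivative_map P _ h).symm

theorem specialize_monic {P : (MvPolynomial (Fin k) K)[X]} (hP : P.Monic) (υ : Fin k → R) :
    (specialize υ P).Monic := hP.map _

theorem natDegree_specialize {P : (MvPolynomial (Fin k) K)[X]} (hP : P.Monic) (υ : Fin k → R) :
    (specialize υ P).natDegree = P.natDegree := hP.natDegree_map _

variable [LinearOrder R]

theorem sign_iterate_derivative_eq {𝒬 : Finset (MvPolynomial (Fin k) K)[X]} {υ₁ υ₂ : Fin k → R}
    {x x' : R} (h : ∀ Q ∈ DerPlusFamily 𝒬, SignType.sign ((specialize υ₁ Q).eval x) =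
      SignType.sign ((specialize υ₂ Q).eval x')) {Q : (MvPolynomial (Fin k) K)[X]} (hQ : Q ∈ 𝒬)
    (hQm : Q.Monic) (j : ℕ) :
    SignType.sign ((derivative^[j] (specialize υ₁ Q)).eval x) =
      SignType.sign ((derivative^[j] (specialize υ₂ Q)).eval x') := by
  rcases Nat.eq_zero_or_pos j with rfl | hj
  · refine h Q ?_
    simp only [DerPlusFamily, Set.mem_iUnion]
    exact ⟨Q, hQ, Set.mem_insert _ _⟩
  rcases le_or_gt j (Q.natDegree - 1) with hj' | hj'
  · rw [← specialize_iterate_derivative, ← specialize_iterate_derivative]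
    refine h _ ?_
    simp only [DerPlusFamily, Set.mem_iUnion]
    exact ⟨Q, hQ, Set.mem_insert_of_mem _ ⟨j, hj, hj', rfl⟩⟩
  · have key : ∀ υ : Fin k → R, derivative^[j] (specialize υ Q) =
        C (if j = Q.natDegree then (j.factorial : R) else 0) := by
      intro υ
      have hd := natDegree_specialize hQm υ
      split_ifs with hjd
      · have h1 : (derivative^[j] (specialize υ Q)).natDegree ≤ 0 := by
          refine (natDegree_iterate_derivative _ _).trans ?_
          omega
        rw [eq_C_of_natDegree_le_zero h1, coeff_iterate_derivative, zero_add]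
        have h2 : (specialize υ Q).coeff j = 1 := by
          rw [hjd, ← hd]; exact (specialize_monic hQm υ).coeff_natDegree
        rw [h2, Nat.descFactorial_self, nsmul_eq_mul, mul_one]
      · rw [iterate_derivative_eq_zero (by omega), map_zero]
    rw [key, key]
    simp

variable [IsStrictOrderedRing R]

theorem cast_sign_mul (a b : R) : ((SignType.sign (a * b) : SignType) : ℤ) =
    (SignType.sign a : SignType) * (SignType.sign b : SignType) := by
  rw [sign_mul, SignType.coe_mul]

theorem cast_sign_prod_pow {ι : Type*} (s : Finset ι) (f : ι → R) (α : ι → ℕ) :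
    ((SignType.sign (∏ i ∈ s, f i ^ α i) : SignType) : ℤ) =
      ∏ i ∈ s, ((SignType.sign (f i) : SignType) : ℤ) ^ α i := by
  have h := map_prod ((SignType.castHom (α := ℤ)).toMonoidHom.comp
    (signHom (α := R)).toMonoidHom) (fun i => f i ^ α i) s
  simp only [map_pow] at h
  exact h

theorem Fin.val_add_one_injective (n : ℕ) : Function.Injective fun i : Fin n => (i : ℕ) + 1 :=
  fun _ _ h => Fin.ext (Nat.succ_injective h)

theorem Icc_one_eq_map (n : ℕ) : Finset.Icc 1 n =
    (Finset.univ : Finset (Fin n)).map ⟨_, Fin.val_add_one_injective n⟩ := by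
  ext h
  rw [Finset.mem_Icc, Finset.mem_map]
  constructor
  · rintro ⟨h1, h2⟩
    exact ⟨⟨h - 1, by omega⟩, Finset.mem_univ _, Nat.sub_add_cancel h1⟩
  · rintro ⟨i, -, rfl⟩
    exact ⟨Nat.succ_pos _, i.2⟩

theorem prod_pow_mem_PDer {A : Type*} [CommRing A] (P : A[X]) {i : ℕ}
    (α : Fin (P.natDegree - 1) → ℕ) (hα : ∀ h, α h ≤ 2)
    (hcard : (Finset.univ.filter fun h => α h ≠ 0).card ≤ i) :
    ∏ h : Fin (P.natDegree - 1), (derivative^[(h : ℕ) + 1] P) ^ α h ∈ PDer i P := by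
  -- The index is shifted by one. At `h = 0` truncated subtraction may give a nonzero exponent,
  -- harmless since the product starts at 1.
  let β : ℕ → ℕ := fun h => if hh : h - 1 < P.natDegree - 1 then α ⟨h - 1, hh⟩ else 0
  have hβ : ∀ h : Fin (P.natDegree - 1), β ((h : ℕ) + 1) = α h := fun h => by simp [β]
  refine ⟨β, fun h => ?_, ?_, ?_⟩
  · simp only [β]
    split_ifs
    · exact hα _
    · omega
  · rw [Icc_one_eq_map, Finset.filter_map, Finset.card_map]
    simpa only [Function.comp_def, Function.Embedding.coeFn_mk, hβ] using hcard
  · rw [Icc_one_eq_map, Finset.prod_map]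
    simp only [Function.Embedding.coeFn_mk, hβ]

/-- The signs of the derivatives of `P`, of orders `1, …, deg P - 1`, at a point, after
specialization of the parameters. -/
noncomputable def thomCode (P : (MvPolynomial (Fin k) K)[X]) (υ : Fin k → R) (x : R) :
    Fin (P.natDegree - 1) → SignType :=
  fun h => SignType.sign ((derivative^[(h : ℕ) + 1] (specialize υ P)).eval x)

theorem cast_sign_eval_prod_pow (P : (MvPolynomial (Fin k) K)[X]) (υ : Fin k → R) (x : R)
    (α : Fin (P.natDegree - 1) → ℕ) :
    ((SignType.sign ((specialize υ (∏ h : Fin (P.natDegree - 1),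
      (derivative^[(h : ℕ) + 1] P) ^ α h)).eval x) : SignType) : ℤ) =
      ∏ h, (thomCode P υ x h : ℤ) ^ α h := by
  rw [specialize_prod_pow, eval_prod]
  simp only [eval_pow, specialize_iterate_derivative]
  exact cast_sign_prod_pow _ _ _

variable [IsRealClosed R]

theorem thomCode_injOn {P : (MvPolynomial (Fin k) K)[X]} (hP : P.Monic) (υ : Fin k → R) {x y : R}
    (hx : (specialize υ P).IsRoot x) (hy : (specialize υ P).IsRoot y)
    (h : thomCode P υ x = thomCode P υ y) : x = y := by
  refine (specialize_monic hP υ).eq_of_sign_iterate_derivative_eq hx hy fun j hj hj' => ?_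
  rw [natDegree_specialize hP] at hj'
  obtain ⟨j, rfl⟩ : ∃ i, j = i + 1 := ⟨j - 1, by omega⟩
  exact congrFun h ⟨j, by omega⟩

/-- The minors specialize to the minors of the specialized Hermite matrices, of the same size since
`P` is monic, and `τ` fixes their signs. -/
theorem sum_sign_eq_of_realization {𝒬 : Finset (MvPolynomial (Fin k) K)[X]}
    {τ : SignCondition (Elim 𝒬)} {υ₁ υ₂ : Fin k → R} (h₁ : υ₁ ∈ Realization τ R)
    (h₂ : υ₂ ∈ Realization τ R) {P : (MvPolynomial (Fin k) K)[X]} (hP : P.Monic)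
    {A : (MvPolynomial (Fin k) K)[X]} (hA : HMi P A ⊆ Elim 𝒬) :
    ∑ x ∈ (specialize υ₁ P).roots.toFinset,
        ((SignType.sign ((specialize υ₁ A).eval x) : SignType) : ℤ) =
      ∑ x ∈ (specialize υ₂ P).roots.toFinset,
        ((SignType.sign ((specialize υ₂ A).eval x) : SignType) : ℤ) := by
  refine sum_sign_roots_eq_of_sign_hermite_eq (specialize_monic hP υ₁) (specialize_monic hP υ₂)
    (by rw [natDegree_specialize hP, natDegree_specialize hP]) fun n hn hn' => ?_
  rw [natDegree_specialize hP] at hn'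
  have hmem : (hermiteBlock P A n).det ∈ Elim 𝒬 := hA ⟨n, hn, hn', rfl⟩
  have e : ∀ υ : Fin k → R, (hermiteBlock (specialize υ P) (specialize υ A) n).det =
      MvPolynomial.aeval υ (hermiteBlock P A n).det := fun υ =>
    (det_hermiteBlock_map (MvPolynomial.aeval υ : MvPolynomial (Fin k) K →ₐ[K] R).toRingHom hP A
      n).symm
  rw [e, e]
  exact (h₁ ⟨_, hmem⟩).trans (h₂ ⟨_, hmem⟩).symm

/-- The roots of a member of the family correspond to each other, with the same signs of all the
derivatives of the members of the family. -/
theorem exists_root_sign_eq {𝒬 : Finset (MvPolynomial (Fin k) K)[X]}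
    {τ : SignCondition (Elim 𝒬)} {υ₁ υ₂ : Fin k → R} (h₁ : υ₁ ∈ Realization τ R)
    (h₂ : υ₂ ∈ Realization τ R) {P : (MvPolynomial (Fin k) K)[X]} (hPQ : P ∈ 𝒬) (hP : P.Monic)
    {x : R} (hx : (specialize υ₁ P).IsRoot x) :
    ∃ x' : R, (specialize υ₂ P).IsRoot x' ∧ ∀ Q ∈ DerPlusFamily 𝒬,
      SignType.sign ((specialize υ₁ Q).eval x) = SignType.sign ((specialize υ₂ Q).eval x') := by
  set Z₁ := (specialize υ₁ P).roots.toFinset with hZ₁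
  set Z₂ := (specialize υ₂ P).roots.toFinset with hZ₂
  have hmem₁ : ∀ {y}, y ∈ Z₁ ↔ (specialize υ₁ P).IsRoot y := fun {y} => by
    rw [hZ₁, Multiset.mem_toFinset, mem_roots (specialize_monic hP υ₁).ne_zero]
  have hmem₂ : ∀ {y}, y ∈ Z₂ ↔ (specialize υ₂ P).IsRoot y := fun {y} => by
    rw [hZ₂, Multiset.mem_toFinset, mem_roots (specialize_monic hP υ₂).ne_zero]
  have hc₁ : Z₁.card ≤ P.natDegree := by
    rw [← natDegree_specialize hP υ₁]
    exact (Multiset.toFinset_card_le _).trans (card_roots' _)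
  have hc₂ : Z₂.card ≤ P.natDegree := by
    rw [← natDegree_specialize hP υ₂]
    exact (Multiset.toFinset_card_le _).trans (card_roots' _)
  have hfib₁ : ∀ (y : R) (w : R → ℤ), y ∈ Z₁ →
      ∑ z ∈ Z₁ with thomCode P υ₁ z = thomCode P υ₁ y, w z = w y := by
    intro y w hy
    refine Finset.sum_eq_single_of_mem y (by simp [hy]) fun z hz hzy => ?_
    rw [Finset.mem_filter] at hz
    exact absurd (thomCode_injOn hP υ₁ (hmem₁.1 hz.1) (hmem₁.1 hy) hz.2) hzy
  have hfib₂ : ∀ (y : R) (w : R → ℤ), y ∈ Z₂ →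
      ∑ z ∈ Z₂ with thomCode P υ₂ z = thomCode P υ₂ y, w z = w y := by
    intro y w hy
    refine Finset.sum_eq_single_of_mem y (by simp [hy]) fun z hz hzy => ?_
    rw [Finset.mem_filter] at hz
    exact absurd (thomCode_injOn hP υ₂ (hmem₂.1 hz.1) (hmem₂.1 hy) hz.2) hzy
  -- With unit weights this compares the numbers of roots with each Thom code. The two sets of codes
  -- have at most `2 * p` elements together, and `2 ^ c ≤ 2 * p < 2 ^ (bit p + 1)` leaves at most
  -- `bit p` nonzero exponents.
  have hcount := sum_filter_eq_of_moments_eq (Z₁ := Z₁) (Z₂ := Z₂) (c₁ := thomCode P υ₁)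
    (c₂ := thomCode P υ₂) (w₁ := fun _ => 1) (w₂ := fun _ => 1) (m := 2 * P.natDegree)
    ((Finset.card_union_le _ _).trans (by
      have := Finset.card_image_le (s := Z₁) (f := thomCode P υ₁)
      have := Finset.card_image_le (s := Z₂) (f := thomCode P υ₂)
      omega))
    (fun α hα hαm => by
      have hsz : (Finset.univ.filter fun i => α i ≠ 0).card ≤ Nat.size P.natDegree := by
        have h1 := Nat.lt_size_self P.natDegree
        rw [← Nat.lt_succ_iff, ← Nat.pow_lt_pow_iff_right (a := 2) (by omega), pow_succ]
        omega
      simp only [one_mul, ← cast_sign_eval_prod_pow]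
      refine sum_sign_eq_of_realization h₁ h₂ hP fun M hM => Or.inl ?_
      simp only [ThElim, Set.mem_iUnion]
      exact ⟨P, hPQ, _, prod_pow_mem_PDer P α hα hsz, hM⟩)
  have hmatch : ∀ y ∈ Z₁, ∃ y' ∈ Z₂, thomCode P υ₂ y' = thomCode P υ₁ y := by
    intro y hy
    have h3 := hcount (thomCode P υ₁ y)
    rw [hfib₁ y _ hy] at h3
    have h4 : (Z₂.filter fun z => thomCode P υ₂ z = thomCode P υ₁ y).Nonempty := by
      rw [Finset.nonempty_iff_ne_empty]
      intro h0
      rw [h0] at h3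
      simp at h3
    obtain ⟨y', hy'⟩ := h4
    exact ⟨y', (Finset.mem_filter.1 hy').1, (Finset.mem_filter.1 hy').2⟩
  -- This inclusion bounds the union of the codes by `p` instead of `2 * p`, saving one exponent
  -- below.
  have hmatch' : Z₂.image (thomCode P υ₂) ⊆ Z₁.image (thomCode P υ₁) := by
    intro σ hσ
    obtain ⟨y, hy, rfl⟩ := Finset.mem_image.1 hσ
    have h3 := hcount (thomCode P υ₂ y)
    rw [hfib₂ y _ hy] at h3
    have h4 : (Z₁.filter fun z => thomCode P υ₁ z = thomCode P υ₂ y).Nonempty := by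
      rw [Finset.nonempty_iff_ne_empty]
      intro h0
      rw [h0] at h3
      simp at h3
    obtain ⟨y', hy'⟩ := h4
    exact Finset.mem_image.2 ⟨y', (Finset.mem_filter.1 hy').1, (Finset.mem_filter.1 hy').2⟩
  have hxZ : x ∈ Z₁ := hmem₁.2 hx
  obtain ⟨x', hx'Z, hxx'⟩ := hmatch x hxZ
  refine ⟨x', hmem₂.1 hx'Z, fun Q hQ => ?_⟩
  by_cases hQP : Q ∈ DerPlus P
  · rcases hQP with rfl | ⟨j, hj, hj', rfl⟩
    · rw [hx.eq_zero, (hmem₂.1 hx'Z).eq_zero]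
    · obtain ⟨j, rfl⟩ : ∃ i, j = i + 1 := ⟨j - 1, by omega⟩
      rw [specialize_iterate_derivative, specialize_iterate_derivative]
      exact (congrFun hxx' ⟨j, by omega⟩).symm
  -- Each fibre of the Thom code is a single root, so weighting by the sign of `Q` returns that sign
  -- itself; the first power of `Q` is enough.
  · have hsum := sum_filter_eq_of_moments_eq (Z₁ := Z₁) (Z₂ := Z₂) (c₁ := thomCode P υ₁)
      (c₂ := thomCode P υ₂)
      (w₁ := fun y => ((SignType.sign ((specialize υ₁ Q).eval y) : SignType) : ℤ))
      (w₂ := fun y => ((SignType.sign ((specialize υ₂ Q).eval y) : SignType) : ℤ))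
      (m := P.natDegree)
      (by
        rw [Finset.union_eq_left.2 hmatch']
        exact Finset.card_image_le.trans hc₁)
      (fun α hα hαm => by
        have hsz : (Finset.univ.filter fun i => α i ≠ 0).card ≤ Nat.size P.natDegree - 1 := by
          have := Nat.lt_size.2 hαm
          omega
        simp only [← cast_sign_eval_prod_pow]
        simp only [← cast_sign_mul, ← eval_mul, ← specialize_mul]
        refine sum_sign_eq_of_realization h₁ h₂ hP fun M hM => Or.inr ?_
        simp only [ThElimWith, Set.mem_iUnion]
        exact ⟨P, hPQ, Q, ⟨hQ, hQP⟩, _,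
          ⟨_, prod_pow_mem_PDer P α hα hsz, Or.inl (mul_comm _ _)⟩, hM⟩)
      (thomCode P υ₁ x)
    rw [hfib₁ x _ hxZ, ← hxx', hfib₂ x' _ hx'Z] at hsum
    revert hsum
    generalize SignType.sign ((specialize υ₁ Q).eval x) = a
    generalize SignType.sign ((specialize υ₂ Q).eval x') = b
    revert a b
    decide

/-- The signs of all derivatives determine the multiplicity of the point as a root and the sign of
the first nonvanishing derivative, which is the sign just to the right. -/
theorem sign_right_eq {f g : R[X]} (hf : f ≠ 0) (hg : g ≠ 0) {x y x' y' : R} (hxy : x < y)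
    (hxy' : x' < y') (hfr : ∀ z, x < z → z ≤ y → ¬ f.IsRoot z)
    (hgr : ∀ z, x' < z → z ≤ y' → ¬ g.IsRoot z)
    (h : ∀ j, SignType.sign ((derivative^[j] f).eval x) =
      SignType.sign ((derivative^[j] g).eval x')) :
    SignType.sign (f.eval y) = SignType.sign (g.eval y') := by
  have hroot : ∀ j, (derivative^[j] f).IsRoot x ↔ (derivative^[j] g).IsRoot x' := fun j => by
    rw [IsRoot, IsRoot, ← sign_eq_zero_iff, h, sign_eq_zero_iff]
  have hmult : f.rootMultiplicity x = g.rootMultiplicity x' := by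
    refine eq_of_forall_lt_iff fun n => ?_
    rw [lt_rootMultiplicity_iff_isRoot_iterate_derivative hf,
      lt_rootMultiplicity_iff_isRoot_iterate_derivative hg]
    simp only [hroot]
  rw [sign_eval_of_forall_Ioc_not_isRoot hxy hfr, sign_eval_of_forall_Ioc_not_isRoot hxy' hgr,
    hmult, h]

theorem realizableSignConditions_subset {𝒬 : Finset (MvPolynomial (Fin k) K)[X]}
    (hmonic : ∀ P ∈ 𝒬, P.Monic) {τ : SignCondition (Elim 𝒬)} {υ₁ υ₂ : Fin k → R}
    (h₁ : υ₁ ∈ Realization τ R) (h₂ : υ₂ ∈ Realization τ R) :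
    realizableSignConditions 𝒬 υ₁ ⊆ realizableSignConditions 𝒬 υ₂ := by
  classical
  rintro σ ⟨y, hy⟩
  suffices h : ∃ y', ∀ P ∈ 𝒬, SignType.sign ((specialize υ₁ P).eval y) =
      SignType.sign ((specialize υ₂ P).eval y') by
    obtain ⟨y', hy'⟩ := h
    exact ⟨y', fun P => (hy' P P.2).symm.trans (hy P)⟩
  have hroots : ∀ υ : Fin k → R, ∃ Z : Finset R, ∀ z, z ∈ Z ↔
      ∃ P ∈ 𝒬, (specialize υ P).IsRoot z := by
    intro υ
    refine ⟨𝒬.biUnion fun P => (specialize υ P).roots.toFinset, fun z => ?_⟩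
    simp only [Finset.mem_biUnion, Multiset.mem_toFinset]
    refine exists_congr fun P => and_congr_right fun hP => ?_
    rw [mem_roots (specialize_monic (hmonic P hP) υ).ne_zero]
  obtain ⟨Z₁, hZ₁⟩ := hroots υ₁
  obtain ⟨Z₂, hZ₂⟩ := hroots υ₂
  -- If no root is at or before `y`, any point to the left of all roots at `υ₂` serves as `y'`.
  rcases (Z₁.filter (· ≤ y)).eq_empty_or_nonempty with hempty | hne
  · have hno : ∀ P ∈ 𝒬, ∀ z, z ≤ y → ¬ (specialize υ₁ P).IsRoot z := fun P hP z hz hr =>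
      Finset.filter_eq_empty_iff.1 hempty ((hZ₁ z).2 ⟨P, hP, hr⟩) hz
    obtain ⟨y', hy'⟩ : ∃ y' : R, ∀ z ∈ Z₂, y' < z := by
      obtain ⟨b, hb⟩ := Z₂.finite_toSet.bddBelow
      exact ⟨b - 1, fun z hz => (sub_one_lt b).trans_le (hb hz)⟩
    refine ⟨y', fun P hP => ?_⟩
    rw [(specialize_monic (hmonic P hP) υ₁).sign_eval_of_forall_le_not_isRoot (hno P hP),
      (specialize_monic (hmonic P hP) υ₂).sign_eval_of_forall_le_not_isRoot fun z hz hr =>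
        (hy' z ((hZ₂ z).2 ⟨P, hP, hr⟩)).not_ge hz,
      natDegree_specialize (hmonic P hP), natDegree_specialize (hmonic P hP)]
  · obtain ⟨x, hx, hxmax⟩ := Finset.exists_max_image _ id hne
    rw [Finset.mem_filter] at hx
    obtain ⟨P, hP, hxP⟩ := (hZ₁ x).1 hx.1
    obtain ⟨x', hx', hsign⟩ := exists_root_sign_eq h₁ h₂ hP (hmonic P hP) hxP
    have hder : ∀ Q ∈ 𝒬, ∀ j, _ := fun Q hQ => sign_iterate_derivative_eq hsign hQ (hmonic Q hQ)
    rcases hx.2.eq_or_lt with rfl | hxy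
    · exact ⟨x', fun Q hQ => hder Q hQ 0⟩
    -- Here `y` lies strictly after its last preceding root `x`, so `y'` is taken after the
    -- counterpart `x'` and before the next root at `υ₂`, if any.
    obtain ⟨y', hxy', hy'⟩ : ∃ y', x' < y' ∧ ∀ z ∈ Z₂, x' < z → y' < z := by
      rcases (Z₂.filter (x' < ·)).eq_empty_or_nonempty with hempty | hne
      · exact ⟨x' + 1, lt_add_one x', fun z hz hz' =>
          absurd hz' (Finset.filter_eq_empty_iff.1 hempty hz)⟩
      · obtain ⟨m, hm, hmin⟩ := Finset.exists_min_image _ id hne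
        obtain ⟨y', h3, h4⟩ := exists_between (Finset.mem_filter.1 hm).2
        exact ⟨y', h3, fun z hz hz' => h4.trans_le (hmin z (Finset.mem_filter.2 ⟨hz, hz'⟩))⟩
    refine ⟨y', fun Q hQ => sign_right_eq (specialize_monic (hmonic Q hQ) υ₁).ne_zero
      (specialize_monic (hmonic Q hQ) υ₂).ne_zero hxy hxy' (fun z hz hz' hr => ?_)
      (fun z hz hz' hr => ?_) (hder Q hQ)⟩
    · exact hz.not_ge (hxmax z (Finset.mem_filter.2 ⟨(hZ₁ z).2 ⟨Q, hQ, hr⟩, hz'⟩))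
    · exact hz'.not_gt (hy' z ((hZ₂ z).2 ⟨Q, hQ, hr⟩) hz)

end Specialization

theorem mainTheorem5 {K R : Type*}
    [Field K] [LinearOrder K] [IsStrictOrderedRing K]
    [Field R] [LinearOrder R] [IsStrictOrderedRing R] [IsRealClosed R]
    [Algebra K R] (hKR : Monotone (algebraMap K R))
    {k : ℕ} (𝒬 : Finset (Polynomial (MvPolynomial (Fin k) K)))
    (hmonic : ∀ P ∈ 𝒬, P.Monic)
    (τ : SignCondition (Elim 𝒬)) (hτ : (Realization τ R).Nonempty) :
    ∃ SIGN : List (SignCondition (𝒬 : Set (Polynomial (MvPolynomial (Fin k) K)))),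
      ∀ υ ∈ Realization τ R, {σ | σ ∈ SIGN} = realizableSignConditions 𝒬 υ := by
  obtain ⟨υ₀, hυ₀⟩ := hτ
  have : Finite (SignCondition (𝒬 : Set (Polynomial (MvPolynomial (Fin k) K)))) :=
    Pi.finite
  -- The list is read off at one chosen point; the inclusion used in both directions makes it valid
  -- at every other one.
  refine ⟨(Set.toFinite (realizableSignConditions 𝒬 υ₀)).toFinset.toList, fun υ hυ => ?_⟩
  ext σ
  simp only [Finset.mem_toList, Set.Finite.mem_toFinset, Set.mem_ofPred_eq]
  exact ⟨fun h => realizableSignConditions_subset hmonic hυ₀ hυ h,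
    fun h => realizableSignConditions_subset hmonic hυ hυ₀ h⟩
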